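/- Let $L$ be a lattice in $\mathbb{R}^2$ (a discrete subgroup spanning $\mathbb{R}^2$) that is admissible: there is $c>0$ with $|l_1l_2|\ge c$ for all $l=(l_1,l_2)\in L\setminus\{0\}$. Let $L^{\perp}=\{x\in\mathbb{R}^2 : \langle l,x\rangle\in\mathbb{Z}\text{ for all } l\in L\}$ be the dual lattice (which is again admissible), and for $M\in\{L,L^{\perp}\}$ and $t>0$ put $$V(M,t)=\sum_{\substack{l\in M\\ 0<\|l\|\le t}}\frac{1}{l_1^2l_2^2},$$ where $\|\cdot\|$ is the Euclidean norm. Then: (1) $V(L,t)=\Theta(\log t)$: there is $C>0$ such that for all sufficiently large $t$, $\frac1C\log t\le V(L,t)\le C\log t$. (2) Let $a,b>0$, let $P=\mathrm{Rect}(a,b)=[-a,a]\times[-b,b]$, and for $t>0$, $X\in\mathbb{R}^2$ let $$\mathcal{R}(tP+X,L)=|(tP+X)\cap L|-t^2\,\frac{\mathrm{Area}(P)}{\mathrm{Covol}(L)},$$ where $\mathrm{Covol}(L)$ is the area of a fundamental domain of $L$. Put $$F(t)=\frac{1}{\mathrm{Covol}(L)}\int_{\mathbb{R}^2/L}\left(\frac{\mathcal{R}(tP+X,L)}{\sqrt{V(L^{\perp},t)}}\right)^{2}dX$$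 (with any value, say $0$, for the small $t$ with $V(L^{\perp},t)=0$). Let $\rho$ be any probability density on $[0,1]$, and for $T>0$ let $t$ be a random element of $[0,T]$ with law $\frac1T\rho\!\left(\frac tT\right)dt$. Then, as $T\to\infty$, $F(t)$ converges in distribution and in probability to the constant $$\frac{1}{4\pi^4\,\mathrm{Covol}(L)^2}.$$ -/

import Mathlib

open MeasureTheory Filter Topology

noncomputable section

/-- The Euclidean plane. -/
abbrev Plane : Type := EuclideanSpace ℝ (Fin 2)

/-- The dual lattice: the vectors whose scalar product with every vector of `L` is an integer. -/
def dualLattice (L : Submodule ℤ Plane) : Submodule ℤ Plane where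
  carrier := {x | ∀ l ∈ L, ∃ n : ℤ, inner ℝ l x = (n : ℝ)}
  add_mem' := by
    intro x y hx hy l hl
    obtain ⟨m, hm⟩ := hx l hl
    obtain ⟨n, hn⟩ := hy l hl
    exact ⟨m + n, by rw [inner_add_right, hm, hn]; push_cast; rfl⟩
  zero_mem' := fun l _ => ⟨0, by simp⟩
  smul_mem' := by
    intro k x hx l hl
    obtain ⟨m, hm⟩ := hx l hl
    refine ⟨k * m, ?_⟩
    rw [← Int.cast_smul_eq_zsmul ℝ k x, real_inner_smul_right, hm]
    push_cast
    rfl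

/-- A lattice is admissible if `|l₁ l₂|` is bounded below by a positive constant on its nonzero
vectors. -/
def Admissible (L : Submodule ℤ Plane) : Prop :=
  ∃ C : ℝ, 0 < C ∧ ∀ l ∈ L, l ≠ 0 → C ≤ |l 0 * l 1|

/-- `V(L,t)`, the sum of `1 / (l₁² l₂²)` over the `l ∈ L` with `0 < ‖l‖ ≤ t`
(a finite sum when `L` is discrete). -/
def latticeSum (L : Submodule ℤ Plane) (t : ℝ) : ℝ :=
  ∑ᶠ l ∈ {l : Plane | l ∈ L ∧ 0 < ‖l‖ ∧ ‖l‖ ≤ t}, 1 / ((l 0) ^ 2 * (l 1) ^ 2)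

/-- The rectangle centred at the origin with vertices `(±a, ±b)`. -/
def Rect (a b : ℝ) : Set Plane := {x | |x 0| ≤ a ∧ |x 1| ≤ b}

/-- The set `t P + X`. -/
def dilateTranslate (t : ℝ) (P : Set Plane) (X : Plane) : Set Plane :=
  (fun x : Plane => t • x + X) '' P

/-- `N(t P + X, L)`, the number of points of `L` in `t P + X`. -/
def pointCount (t : ℝ) (P : Set Plane) (X : Plane) (L : Submodule ℤ Plane) : ℕ :=
  (dilateTranslate t P X ∩ (L : Set Plane)).ncard

/-- The error term `N(t P + X, L) - t² Area(P) / Covol(L)`. -/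
def countError (t : ℝ) (P : Set Plane) (X : Plane) (L : Submodule ℤ Plane) : ℝ :=
  (pointCount t P X L : ℝ) - t ^ 2 * (volume.real P / ZLattice.covolume L)

/-- The mean `(1 / Covol(L)) ∫ f` of an `L`-periodic function over `ℝ² / L`, computed on a
fundamental domain `D` of `L`. -/
def periodMean (L : Submodule ℤ Plane) (D : Set Plane) (f : Plane → ℝ) : ℝ :=
  (1 / ZLattice.covolume L) * ∫ X in D, f X

/-- The mean over `X ∈ ℝ² / L` of `(𝓡(t P + X, L) / √V(L^⊥, t))²`. -/
def normalizedSecondMoment (L : Submodule ℤ Plane) (D : Set Plane) (P : Set Plane) (t : ℝ) : ℝ :=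
  periodMean L D
    (fun X => (countError t P X L / Real.sqrt (latticeSum (dualLattice L) t)) ^ 2)

/-- A probability density on `[0, 1]`; only the values on `[0, 1]` matter. -/
structure UnitDensity where
  /-- the density -/
  toFun : ℝ → ℝ
  measurable_toFun : Measurable toFun
  nonneg : ∀ x ∈ Set.Icc (0 : ℝ) 1, 0 ≤ toFun x
  integral_eq_one : ∫ x in Set.Icc (0 : ℝ) 1, toFun x = 1

/-- The measure `(1 / T) ρ(t / T) dt` on `[0, T]`. -/
def UnitDensity.dilatedLaw (ρ : UnitDensity) (T : ℝ) : Measure ℝ :=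
  (volume.restrict (Set.Icc 0 T)).withDensity
    (fun t => ENNReal.ofReal (1 / T * ρ.toFun (t / T)))

instance UnitDensity.isProbabilityMeasure_dilatedLaw (ρ : UnitDensity) (T : Set.Ioi (0 : ℝ)) :
    IsProbabilityMeasure (ρ.dilatedLaw (T : ℝ)) := by
  obtain ⟨T, hT⟩ := T
  have hT : 0 < T := hT
  constructor
  have h1 : ∫ x in (0 : ℝ)..1, ρ.toFun x = 1 := by
    rw [intervalIntegral.integral_of_le zero_le_one, ← integral_Icc_eq_integral_Ioc]
    exact ρ.integral_eq_one
  have h2 : ∫ t in Set.Icc 0 T, 1 / T * ρ.toFun (t / T) = 1 := by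
    rw [integral_Icc_eq_integral_Ioc, ← intervalIntegral.integral_of_le hT.le,
      intervalIntegral.integral_const_mul, intervalIntegral.integral_comp_div _ hT.ne', zero_div,
      div_self hT.ne', h1, smul_eq_mul]
    field_simp
  have h3 : Integrable (fun t => 1 / T * ρ.toFun (t / T)) (volume.restrict (Set.Icc 0 T)) := by
    by_contra h
    rw [integral_undef h] at h2
    exact zero_ne_one h2
  have h4 : 0 ≤ᵐ[volume.restrict (Set.Icc 0 T)] fun t => 1 / T * ρ.toFun (t / T) := by
    filter_upwards [ae_restrict_mem measurableSet_Icc] with t ht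
    exact mul_nonneg (by positivity)
      (ρ.nonneg _ ⟨div_nonneg ht.1 hT.le, (div_le_one hT).2 ht.2⟩)
  change ((volume.restrict (Set.Icc 0 T)).withDensity _) Set.univ = 1
  rw [withDensity_apply _ MeasurableSet.univ, Measure.restrict_univ,
    ← ofReal_integral_eq_lintegral_ofReal h3 h4, h2, ENNReal.ofReal_one]

end

/-! Put M = L^⊥. The point count of tP + X is the L-periodization of the indicator of a rectangle,
so Parseval on ℝ²/L (`Admissible.hasSum_periodMean`) turns the mean square of the error into 1/(π⁴
Covol(L)²) times the sum over nonzero m in M of sin²(2πatm₁) sin²(2πbtm₂)/(m₁²m₂²). Each sine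
product has time average 1/4, so the sum should be close to V(M,t)/4, and the limit 1/(4π⁴
Covol(L)²) follows once the fluctuations are shown to be o(V).

Everything rests on one geometric fact, `Admissible.exists_sum_forms_le`: under two suitably
independent linear forms, an admissible lattice has a bounded number of points per unit box,
uniformly in the translation and in area-preserving diagonal scalings. It makes the sum of the
weights over a shell r < ‖m‖ ≤ κr bounded, so V grows at most logarithmically and varies slowly. It
also bounds the frequencies beyond T at all times t ≤ T. Minkowski's theorem in thin boxes supplies
the lower bound log t ≪ V.

For the frequencies up to T, subtracting V(M,T)/4 leaves four cosine sums. A large sieve inequality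
(`integral_sq_sum_cos_le`), fed by the same geometric fact, bounds their mean squares on [0,T] by
O(V(M,T)). Chebyshev's inequality then bounds the proportion of bad times by O(1/V(M,T)), which
tends to 0 (`Admissible.eventually_volume_deviation_le`). Absolute continuity of ρ carries this from
the uniform law to the dilated laws, and convergence in probability to a constant gives convergence
in distribution. -/

noncomputable section

/-! ### Cauchy mass of separated configurations and of admissible lattices -/

/-- The floor n satisfies n² ≤ 2x² + 2. This compares a sum over scattered points with a sum over
integers. -/
lemma one_div_one_add_sq_le_floor (x : ℝ) :
    1 / (1 + x ^ 2) ≤ 3 * (1 / (1 + (⌊x⌋ : ℝ) ^ 2)) := by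
  have h1 := Int.floor_le x
  have h2 := Int.lt_floor_add_one x
  set n : ℝ := (⌊x⌋ : ℝ)
  rw [mul_one_div, div_le_div_iff₀ (by positivity) (by positivity)]
  nlinarith [sq_nonneg (x + (x - n)), sq_nonneg (x - (x - n))]

lemma summable_one_div_one_add_sq : Summable (fun n : ℤ => 1 / (1 + (n : ℝ) ^ 2)) := by
  have h : Summable (fun n : ℤ => 1 / (n : ℝ) ^ 2) :=
    Real.summable_one_div_int_pow.mpr (by norm_num)
  refine Summable.of_norm_bounded_eventually h ?_
  have : ({0}ᶜ : Set ℤ) ∈ cofinite := (Set.finite_singleton 0).compl_mem_cofinite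
  filter_upwards [this] with n hn
  have hn : (n : ℝ) ≠ 0 := by simpa using hn
  have : 0 < (n : ℝ) ^ 2 := by positivity
  rw [Real.norm_of_nonneg (by positivity)]
  exact one_div_le_one_div_of_le this (by linarith)

/-- Points of a plane configuration with at most one point per unit box carry bounded Cauchy
mass. -/
lemma exists_sum_le_of_separated : ∃ C : ℝ, 0 < C ∧ ∀ (S : Finset Plane) (f g : Plane → ℝ),
    (∀ x ∈ S, ∀ y ∈ S, |f x - f y| < 1 → |g x - g y| < 1 → x = y) →
    ∑ x ∈ S, 1 / (1 + f x ^ 2) * (1 / (1 + g x ^ 2)) ≤ C := by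
  classical
  set φ : ℤ → ℝ := fun n => 1 / (1 + (n : ℝ) ^ 2) with hφ
  have hφ0 : ∀ n, 0 ≤ φ n := fun n => by simp only [hφ]; positivity
  have hs : Summable (fun p : ℤ × ℤ => φ p.1 * φ p.2) :=
    summable_one_div_one_add_sq.mul_of_nonneg summable_one_div_one_add_sq hφ0 hφ0
  have hn : 0 ≤ ∑' p : ℤ × ℤ, φ p.1 * φ p.2 :=
    tsum_nonneg fun p => mul_nonneg (hφ0 _) (hφ0 _)
  refine ⟨9 * (∑' p : ℤ × ℤ, φ p.1 * φ p.2) + 1, by positivity, fun S f g h => ?_⟩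
  -- Separation puts at most one point in each integer cell, so the sum is dominated by a convergent
  -- series over ℤ².
  have hinj : Set.InjOn (fun x => ((⌊f x⌋, ⌊g x⌋) : ℤ × ℤ)) S := by
    intro x hx y hy hxy
    simp only [Prod.mk.injEq] at hxy
    exact h x hx y hy (Int.abs_sub_lt_one_of_floor_eq_floor hxy.1)
      (Int.abs_sub_lt_one_of_floor_eq_floor hxy.2)
  calc ∑ x ∈ S, 1 / (1 + f x ^ 2) * (1 / (1 + g x ^ 2))
      ≤ ∑ x ∈ S, 9 * (φ ⌊f x⌋ * φ ⌊g x⌋) := by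
        refine Finset.sum_le_sum fun x _ => ?_
        have := mul_le_mul (one_div_one_add_sq_le_floor (f x))
          (one_div_one_add_sq_le_floor (g x)) (by positivity) (by positivity)
        simp only [hφ]
        linarith
    _ = 9 * ∑ p ∈ S.image (fun x => ((⌊f x⌋, ⌊g x⌋) : ℤ × ℤ)), φ p.1 * φ p.2 := by
        rw [Finset.sum_image hinj, Finset.mul_sum]
    _ ≤ 9 * ∑' p : ℤ × ℤ, φ p.1 * φ p.2 := by
        gcongr
        exact hs.sum_le_tsum _ fun p _ => mul_nonneg (hφ0 _) (hφ0 _)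
    _ ≤ _ := by linarith

lemma Plane.ext {x y : Plane} (h0 : x 0 = y 0) (h1 : x 1 = y 1) : x = y := by
  ext i; fin_cases i <;> assumption

lemma Plane.norm_sq (x : Plane) : ‖x‖ ^ 2 = x 0 ^ 2 + x 1 ^ 2 := by
  rw [EuclideanSpace.norm_sq_eq]; simp

lemma one_div_one_add_sq_le_mul {N : ℝ} (hN : 1 ≤ N) (x : ℝ) :
    1 / (1 + x ^ 2) ≤ N ^ 2 * (1 / (1 + (N * x) ^ 2)) := by
  rw [mul_one_div, div_le_div_iff₀ (by positivity) (by positivity)]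
  nlinarith [sq_nonneg x]

lemma abs_mul_sub_mul_le {f g a b : ℝ} (hf : |f| ≤ 1) (hg : |g| ≤ 1) :
    |a * f - b * g| ≤ |a| + |b| := by
  refine (abs_sub _ _).trans (add_le_add ?_ ?_) <;> rw [abs_mul]
  · exact mul_le_of_le_one_right (abs_nonneg _) hf
  · exact mul_le_of_le_one_right (abs_nonneg _) hg

/-- The Cauchy mass of an admissible lattice with respect to a pair of independent affine forms is
bounded, uniformly in the translation and in diagonal changes of scale. -/
lemma Admissible.exists_sum_forms_le {M : Submodule ℤ Plane} (hM : Admissible M) (K : ℝ) :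
    ∃ C : ℝ, 0 < C ∧ ∀ p q r s μ ν : ℝ, p * s - q * r ≠ 0 →
      (|s| + |q|) * (|p| + |r|) ≤ K * (p * s - q * r) ^ 2 →
      ∀ S : Finset Plane, (∀ l ∈ S, l ∈ M) →
      ∑ l ∈ S, 1 / (1 + (p * l 0 + q * l 1 - μ) ^ 2) * (1 / (1 + (r * l 0 + s * l 1 - ν) ^ 2))
        ≤ C := by
  obtain ⟨c, hc, hadm⟩ := hM
  obtain ⟨C₀, hC₀, hsum⟩ := exists_sum_le_of_separated
  -- Chosen so that N²c > |K|. Two points whose N-dilated forms differ by less than 1 would differ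
  -- by a lattice vector (u, v) with N²|uv| ≤ K, against admissibility. The dilation costs a factor
  -- N² per form.
  set N : ℝ := 1 + |K| / c with hNdef
  have hN : 1 ≤ N := by rw [hNdef]; have : 0 ≤ |K| / c := by positivity
                        linarith
  refine ⟨N ^ 4 * C₀, by positivity, fun p q r s μ ν hdet hK S hS => ?_⟩
  have key := hsum S (fun l => N * (p * l 0 + q * l 1 - μ)) (fun l => N * (r * l 0 + s * l 1 - ν)) ?_
  · calc _ ≤ ∑ l ∈ S, N ^ 4 * (1 / (1 + (N * (p * l 0 + q * l 1 - μ)) ^ 2)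
            * (1 / (1 + (N * (r * l 0 + s * l 1 - ν)) ^ 2))) := by
          refine Finset.sum_le_sum fun l _ => ?_
          have := mul_le_mul (one_div_one_add_sq_le_mul hN (p * l 0 + q * l 1 - μ))
            (one_div_one_add_sq_le_mul hN (r * l 0 + s * l 1 - ν)) (by positivity) (by positivity)
          refine this.trans (le_of_eq (by ring))
      _ ≤ N ^ 4 * C₀ := by rw [← Finset.mul_sum]; gcongr
  intro x hx y hy hf hg
  by_contra hne
  have h := hadm (x - y) (M.sub_mem (hS x hx) (hS y hy)) (sub_ne_zero.mpr hne)
  simp only [PiLp.sub_apply] at h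
  set u := x 0 - y 0 with hu
  set v := x 1 - y 1 with hv
  have hf' : |N * (p * u + q * v)| < 1 := by
    convert hf using 2; rw [hu, hv]; ring
  have hg' : |N * (r * u + s * v)| < 1 := by
    convert hg using 2; rw [hu, hv]; ring
  set f := N * (p * u + q * v) with hfdef
  set g := N * (r * u + s * v) with hgdef
  set d := p * s - q * r with hd
  -- Cramer's rule: the lattice vector is recovered from the values of the two forms.
  have e0 : N * d * u = s * f - q * g := by rw [hfdef, hgdef, hd]; ring
  have e1 : N * d * v = p * g - r * f := by rw [hfdef, hgdef, hd]; ring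
  have b0 : |N * d * u| ≤ |s| + |q| := by
    rw [e0]; exact abs_mul_sub_mul_le hf'.le hg'.le
  have b1 : |N * d * v| ≤ |p| + |r| := by
    rw [e1]; exact abs_mul_sub_mul_le hg'.le hf'.le
  have hprod : N ^ 2 * d ^ 2 * |u * v| ≤ K * d ^ 2 := by
    refine le_trans (le_of_eq ?_) ((mul_le_mul b0 b1 (abs_nonneg _) (by positivity)).trans hK)
    rw [← abs_mul, show N * d * u * (N * d * v) = N ^ 2 * d ^ 2 * (u * v) by ring,
      abs_mul (N ^ 2 * d ^ 2), abs_of_nonneg (by positivity : 0 ≤ N ^ 2 * d ^ 2)]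
  have hd2 : 0 < d ^ 2 := by positivity
  have h3 : N ^ 2 * |u * v| ≤ K := by
    have : d ^ 2 * (N ^ 2 * |u * v|) ≤ d ^ 2 * K := by linarith
    exact le_of_mul_le_mul_left this hd2
  have h4 : N ^ 2 * c ≤ |K| := by
    have : N ^ 2 * c ≤ N ^ 2 * |u * v| := by gcongr
    linarith [le_abs_self K]
  have h5 : N * c = c + |K| := by rw [hNdef]; field_simp
  nlinarith [mul_le_mul_of_nonneg_right hN (by positivity : (0:ℝ) ≤ N * c)]

/-! ### Shell and tail bounds for the weights -/

/-- The summand `1 / (l₀² l₁²)`. -/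
def weight (l : Plane) : ℝ := 1 / ((l 0) ^ 2 * (l 1) ^ 2)

lemma weight_nonneg (l : Plane) : 0 ≤ weight l := by unfold weight; positivity

lemma Admissible.coord_ne_zero {M : Submodule ℤ Plane} (hM : Admissible M) {l : Plane}
    (hl : l ∈ M) (h0 : l ≠ 0) : l 0 ≠ 0 ∧ l 1 ≠ 0 := by
  obtain ⟨c, hc, h⟩ := hM
  have := hc.trans_le (h l hl h0)
  rw [abs_pos] at this
  exact ⟨left_ne_zero_of_mul this, right_ne_zero_of_mul this⟩

/-- The Cauchy mass in a box of shape `u⁻¹ × u`. -/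
def boxMass (u : ℝ) (l : Plane) : ℝ := 1 / (1 + (u * l 0) ^ 2) * (1 / (1 + (u⁻¹ * l 1) ^ 2))

lemma boxMass_nonneg (u : ℝ) (l : Plane) : 0 ≤ boxMass u l := by unfold boxMass; positivity

/-- The diagonal forms have determinant 1 and satisfy the independence condition with K = 1 for
every u, whence the uniformity. -/
lemma Admissible.exists_sum_boxMass_le {M : Submodule ℤ Plane} (hM : Admissible M) :
    ∃ C : ℝ, 0 < C ∧ ∀ u : ℝ, 0 < u → ∀ S : Finset Plane, (∀ l ∈ S, l ∈ M) →
      ∑ l ∈ S, boxMass u l ≤ C := by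
  obtain ⟨C, hC, h⟩ := hM.exists_sum_forms_le 1
  refine ⟨C, hC, fun u hu S hS => ?_⟩
  have := h u 0 0 u⁻¹ 0 0 (by simp [hu.ne']) (by simp [abs_of_pos hu, hu.ne']) S hS
  simpa [boxMass] using this

lemma one_div_sq_le_of_large {x T : ℝ} (hT : 0 < T) (hx : T ^ 2 / 2 ≤ x ^ 2) :
    1 / x ^ 2 ≤ 3 / T ^ 2 * (1 / (1 + (T⁻¹ * x) ^ 2)) := by
  have hx' : 0 < x ^ 2 := lt_of_lt_of_le (by positivity) hx
  have : 3 / T ^ 2 * (1 / (1 + (T⁻¹ * x) ^ 2)) = 3 / (T ^ 2 + x ^ 2) := by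
    field_simp
  rw [this, div_le_div_iff₀ hx' (by positivity)]
  linarith

lemma div_sq_le_of_small {x T s A : ℝ} (hT : 0 < T) (hx : x ≠ 0)
    (h : s * (1 + (T * x) ^ 2) ≤ A * (T * x) ^ 2) :
    s / x ^ 2 ≤ A * T ^ 2 * (1 / (1 + (T * x) ^ 2)) := by
  rw [mul_one_div, div_le_div_iff₀ (by positivity) (by positivity)]
  linarith [mul_pow T x 2]

/-- Outside the disc of radius `T`, a product of damped reciprocal squares is controlled by the
masses of the two boxes `T⁻¹ × T` and `T × T⁻¹`. -/
lemma weight_mul_le_boxMass {l : Plane} {T s₀ s₁ A : ℝ} (hT : 0 < T) (h0 : l 0 ≠ 0) (h1 : l 1 ≠ 0)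
    (hl : T < ‖l‖) (hs₁ : 0 ≤ s₁) (hs₀' : s₀ ≤ 1) (hs₁' : s₁ ≤ 1) (hA : 0 ≤ A)
    (hb₀ : s₀ * (1 + (T * l 0) ^ 2) ≤ A * (T * l 0) ^ 2)
    (hb₁ : s₁ * (1 + (T * l 1) ^ 2) ≤ A * (T * l 1) ^ 2) :
    weight l * (s₀ * s₁) ≤ 3 * A * (boxMass T l + boxMass T⁻¹ l) := by
  have hw : weight l * (s₀ * s₁) = s₀ / (l 0) ^ 2 * (s₁ / (l 1) ^ 2) := by
    unfold weight; field_simp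
  have hn : T ^ 2 < l 0 ^ 2 + l 1 ^ 2 := by
    rw [← Plane.norm_sq]; gcongr
  have p0 := boxMass_nonneg T l
  have p1 := boxMass_nonneg T⁻¹ l
  rw [hw]
  -- Outside the disc one coordinate has square at least T²/2. Its reciprocal square is a wide
  -- Cauchy kernel of height T⁻², and the damping of the other coordinate gives a narrow kernel of
  -- height T².
  rcases le_total (T ^ 2 / 2) (l 1 ^ 2) with h | h
  · have e1 : s₁ / l 1 ^ 2 ≤ 1 / l 1 ^ 2 := by gcongr
    have := mul_le_mul (div_sq_le_of_small hT h0 hb₀) (e1.trans (one_div_sq_le_of_large hT h))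
      (by positivity) (by positivity)
    refine this.trans ?_
    have : A * T ^ 2 * (1 / (1 + (T * l 0) ^ 2)) * (3 / T ^ 2 * (1 / (1 + (T⁻¹ * l 1) ^ 2)))
        = 3 * A * boxMass T l := by
      unfold boxMass; field_simp
    rw [this]
    gcongr
    linarith
  · have h : T ^ 2 / 2 ≤ l 0 ^ 2 := by linarith
    have e1 : s₀ / l 0 ^ 2 ≤ 1 / l 0 ^ 2 := by gcongr
    have := mul_le_mul (e1.trans (one_div_sq_le_of_large hT h)) (div_sq_le_of_small hT h1 hb₁)
      (by positivity) (by positivity)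
    refine this.trans ?_
    have : 3 / T ^ 2 * (1 / (1 + (T⁻¹ * l 0) ^ 2)) * (A * T ^ 2 * (1 / (1 + (T * l 1) ^ 2)))
        = 3 * A * boxMass T⁻¹ l := by
      unfold boxMass; field_simp
    rw [this]
    gcongr
    linarith

lemma Plane.abs_coord_le (l : Plane) : |l 0| ≤ ‖l‖ ∧ |l 1| ≤ ‖l‖ := by
  have := Plane.norm_sq l
  constructor <;> refine abs_le_of_sq_le_sq ?_ (norm_nonneg _) <;>
    linarith [sq_nonneg (l 0), sq_nonneg (l 1)]

/-- The sum of the weights over a dilation-invariant shell is bounded. -/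
lemma Admissible.exists_sum_shell_le {M : Submodule ℤ Plane} (hM : Admissible M) (κ : ℝ) :
    ∃ C : ℝ, 0 < C ∧ ∀ r : ℝ, 0 < r → ∀ S : Finset Plane,
      (∀ l ∈ S, l ∈ M ∧ r < ‖l‖ ∧ ‖l‖ ≤ κ * r) → ∑ l ∈ S, weight l ≤ C := by
  obtain ⟨C, hC, h⟩ := hM.exists_sum_boxMass_le
  have hM' := hM
  obtain ⟨c, hc, hadm⟩ := hM
  refine ⟨3 * (1 + κ ^ 2 / c ^ 2) * (C + C), by positivity, fun r hr S hS => ?_⟩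
  calc ∑ l ∈ S, weight l
      ≤ ∑ l ∈ S, 3 * (1 + κ ^ 2 / c ^ 2) * (boxMass r l + boxMass r⁻¹ l) := by
        refine Finset.sum_le_sum fun l hl => ?_
        obtain ⟨hlM, hl1, hl2⟩ := hS l hl
        have hne : l ≠ 0 := by rintro rfl; simp at hl1; linarith
        obtain ⟨n0, n1⟩ := hM'.coord_ne_zero hlM hne
        have had := hadm l hlM hne
        obtain ⟨a0, a1⟩ := Plane.abs_coord_le l
        -- No sine is present here. Instead, admissibility and ‖l‖ ≤ κr bound r|x| below by c/κ,
        -- which plays the role of the damping.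
        have aux : ∀ x y : ℝ, |y| ≤ ‖l‖ → c ≤ |x * y| →
            1 * (1 + (r * x) ^ 2) ≤ (1 + κ ^ 2 / c ^ 2) * (r * x) ^ 2 := by
          intro x y hy hxy
          have h1 : c ≤ |x| * (κ * r) := by
            rw [abs_mul] at hxy
            exact hxy.trans (by gcongr; exact hy.trans hl2)
          have h2 : c ^ 2 ≤ κ ^ 2 * (r * x) ^ 2 := by
            have : c ^ 2 ≤ (|x| * (κ * r)) ^ 2 := by gcongr
            rw [mul_pow, sq_abs] at this
            linarith
          have h3 : 1 ≤ κ ^ 2 / c ^ 2 * (r * x) ^ 2 := by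
            rw [div_mul_eq_mul_div, le_div_iff₀ (by positivity)]; linarith
          linarith
        have := weight_mul_le_boxMass (s₀ := 1) (s₁ := 1) hr n0 n1 hl1 zero_le_one le_rfl le_rfl
          (by positivity : 0 ≤ 1 + κ ^ 2 / c ^ 2) (aux _ _ a1 had)
          (aux _ _ a0 (by rwa [mul_comm]))
        simpa using this
    _ ≤ _ := by
        rw [← Finset.mul_sum, Finset.sum_add_distrib]
        gcongr
        · exact h r hr S fun l hl => (hS l hl).1
        · exact h r⁻¹ (by positivity) S fun l hl => (hS l hl).1

/-- The frequencies beyond `T` contribute a bounded amount at all times up to `T`. -/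
lemma Admissible.exists_sum_tail_le {M : Submodule ℤ Plane} (hM : Admissible M) (α β : ℝ) :
    ∃ C : ℝ, 0 < C ∧ ∀ T t : ℝ, 0 < T → 0 ≤ t → t ≤ T → ∀ S : Finset Plane,
      (∀ l ∈ S, l ∈ M ∧ T < ‖l‖) →
      ∑ l ∈ S, weight l * (Real.sin (α * t * l 0) ^ 2 * Real.sin (β * t * l 1) ^ 2) ≤ C := by
  obtain ⟨C, hC, h⟩ := hM.exists_sum_boxMass_le
  refine ⟨3 * (1 + α ^ 2 + β ^ 2) * (C + C), by positivity, fun T t hT ht htT S hS => ?_⟩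
  calc _ ≤ ∑ l ∈ S, 3 * (1 + α ^ 2 + β ^ 2) * (boxMass T l + boxMass T⁻¹ l) := by
        refine Finset.sum_le_sum fun l hl => ?_
        obtain ⟨hlM, hl1⟩ := hS l hl
        have hne : l ≠ 0 := by rintro rfl; simp at hl1; linarith
        obtain ⟨n0, n1⟩ := hM.coord_ne_zero hlM hne
        -- The damping is sin² y ≤ min(1, y²), combined with t ≤ T.
        have aux : ∀ γ x : ℝ, γ ^ 2 ≤ α ^ 2 + β ^ 2 →
            Real.sin (γ * t * x) ^ 2 * (1 + (T * x) ^ 2) ≤ (1 + α ^ 2 + β ^ 2) * (T * x) ^ 2 := by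
          intro γ x hγ
          have h1 : Real.sin (γ * t * x) ^ 2 ≤ 1 := Real.sin_sq_le_one _
          have h2 : Real.sin (γ * t * x) ^ 2 ≤ (γ * t * x) ^ 2 :=
            sq_le_sq.mpr Real.abs_sin_le_abs
          have h3 : (γ * t * x) ^ 2 ≤ (α ^ 2 + β ^ 2) * (T * x) ^ 2 := by
            rw [mul_assoc, mul_pow, mul_pow t x, mul_pow T x]
            gcongr
          nlinarith [sq_nonneg (T * x)]
        exact weight_mul_le_boxMass hT n0 n1 hl1 (sq_nonneg _)
          (Real.sin_sq_le_one _) (Real.sin_sq_le_one _) (by positivity)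
          (aux α _ (by nlinarith [sq_nonneg β])) (aux β _ (by nlinarith [sq_nonneg α]))
    _ ≤ _ := by
        rw [← Finset.mul_sum, Finset.sum_add_distrib]
        gcongr
        · exact h T hT S fun l hl => (hS l hl).1
        · exact h T⁻¹ (by positivity) S fun l hl => (hS l hl).1

/-! ### Logarithmic growth of the lattice sum -/

/-- Each point of the ball carries mass at least (1 + t²)⁻² and the total mass is bounded. Only
admissibility enters, so the dual lattice needs no separate proof of discreteness. Finiteness keeps
the `finsum` in `latticeSum` from taking its default value 0. -/
lemma Admissible.finite_ball {M : Submodule ℤ Plane} (hM : Admissible M) (t : ℝ) :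
    {l : Plane | l ∈ M ∧ 0 < ‖l‖ ∧ ‖l‖ ≤ t}.Finite := by
  obtain ⟨C, hC, h⟩ := hM.exists_sum_boxMass_le
  by_contra hinf
  obtain ⟨S, hS, hcard⟩ := Set.Infinite.exists_subset_card_eq hinf
    (⌈C * (1 + t ^ 2) ^ 2⌉₊ + 1)
  have h1 := h 1 one_pos S fun l hl => (hS hl).1
  have h2 : ∑ l ∈ S, 1 / (1 + t ^ 2) ^ 2 ≤ ∑ l ∈ S, boxMass 1 l := by
    refine Finset.sum_le_sum fun l hl => ?_
    have ht := (hS hl).2.2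
    have h0 : l 0 ^ 2 ≤ t ^ 2 := sq_le_sq' (by linarith [neg_abs_le (l 0), (Plane.abs_coord_le l).1])
      (by linarith [le_abs_self (l 0), (Plane.abs_coord_le l).1])
    have h1 : l 1 ^ 2 ≤ t ^ 2 := sq_le_sq' (by linarith [neg_abs_le (l 1), (Plane.abs_coord_le l).2])
      (by linarith [le_abs_self (l 1), (Plane.abs_coord_le l).2])
    unfold boxMass
    rw [div_mul_div_comm, one_mul, sq, inv_one, one_mul, one_mul]
    gcongr
  rw [Finset.sum_const, hcard, nsmul_eq_mul, mul_one_div] at h2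
  have h3 := h2.trans h1
  rw [div_le_iff₀ (by positivity)] at h3
  have h4 := Nat.le_ceil (C * (1 + t ^ 2) ^ 2)
  push_cast at h3
  linarith

/-- The nonzero points of `M` of norm at most `t`. -/
def ballFinset (M : Submodule ℤ Plane) (t : ℝ) : Finset Plane :=
  open Classical in
  if h : {l : Plane | l ∈ M ∧ 0 < ‖l‖ ∧ ‖l‖ ≤ t}.Finite then h.toFinset else ∅

lemma Admissible.mem_ballFinset {M : Submodule ℤ Plane} (hM : Admissible M) {t : ℝ} {l : Plane} :
    l ∈ ballFinset M t ↔ l ∈ M ∧ 0 < ‖l‖ ∧ ‖l‖ ≤ t := by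
  rw [ballFinset, dif_pos (hM.finite_ball t)]; simp

lemma Admissible.latticeSum_eq {M : Submodule ℤ Plane} (hM : Admissible M) (t : ℝ) :
    latticeSum M t = ∑ l ∈ ballFinset M t, weight l := by
  rw [latticeSum, finsum_mem_eq_finite_toFinset_sum _ (hM.finite_ball t), ballFinset,
    dif_pos (hM.finite_ball t)]
  rfl

lemma Admissible.latticeSum_mono {M : Submodule ℤ Plane} (hM : Admissible M) :
    Monotone (latticeSum M) := by
  intro s t hst
  rw [hM.latticeSum_eq, hM.latticeSum_eq]
  refine Finset.sum_le_sum_of_subset_of_nonneg (fun l hl => ?_) fun l _ _ => weight_nonneg l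
  rw [hM.mem_ballFinset] at hl ⊢
  exact ⟨hl.1, hl.2.1, hl.2.2.trans hst⟩

lemma Admissible.latticeSum_nonneg {M : Submodule ℤ Plane} (hM : Admissible M) (t : ℝ) :
    0 ≤ latticeSum M t := by
  rw [hM.latticeSum_eq]; exact Finset.sum_nonneg fun l _ => weight_nonneg l

/-- Slow variation, from the shell bound. It yields the logarithmic upper bound by iteration, and
later replaces V(t) by V(T) for t between θT and T. -/
lemma Admissible.exists_latticeSum_mul_le {M : Submodule ℤ Plane} (hM : Admissible M) (κ : ℝ) :
    ∃ C : ℝ, 0 < C ∧ ∀ r : ℝ, 0 < r → latticeSum M (κ * r) ≤ latticeSum M r + C := by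
  classical
  obtain ⟨C, hC, h⟩ := hM.exists_sum_shell_le κ
  refine ⟨C, hC, fun r hr => ?_⟩
  rw [hM.latticeSum_eq, hM.latticeSum_eq,
    ← Finset.sum_filter_add_sum_filter_not (ballFinset M (κ * r)) (fun l => ‖l‖ ≤ r)]
  refine add_le_add ?_ ?_
  · refine Finset.sum_le_sum_of_subset_of_nonneg (fun l hl => ?_) fun l _ _ => weight_nonneg l
    rw [Finset.mem_filter, hM.mem_ballFinset] at hl
    rw [hM.mem_ballFinset]
    exact ⟨hl.1.1, hl.1.2.1, hl.2⟩
  · refine h r hr _ fun l hl => ?_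
    rw [Finset.mem_filter, hM.mem_ballFinset] at hl
    exact ⟨hl.1.1, not_le.mp hl.2, hl.1.2.2⟩

lemma Admissible.exists_latticeSum_le_log {M : Submodule ℤ Plane} (hM : Admissible M) :
    ∃ C : ℝ, 0 < C ∧ ∀ t : ℝ, Real.exp 1 ≤ t → latticeSum M t ≤ C * Real.log t := by
  obtain ⟨C, hC, h⟩ := hM.exists_latticeSum_mul_le (Real.exp 1)
  have hV := hM.latticeSum_nonneg 1
  have hn : ∀ n : ℕ, latticeSum M (Real.exp n) ≤ latticeSum M 1 + C * n := by
    intro n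
    induction n with
    | zero => simp
    | succ n ih =>
      have := h (Real.exp n) (Real.exp_pos _)
      rw [← Real.exp_add, add_comm] at this
      push_cast
      linarith
  refine ⟨latticeSum M 1 + 2 * C, by linarith, fun t ht => ?_⟩
  have ht0 : 0 < t := (Real.exp_pos 1).trans_le ht
  have hl : 1 ≤ Real.log t := (Real.le_log_iff_exp_le ht0).mpr ht
  have h1 : latticeSum M t ≤ latticeSum M (Real.exp ⌈Real.log t⌉₊) := by
    refine hM.latticeSum_mono ?_
    rw [← Real.log_le_iff_le_exp ht0]
    exact Nat.le_ceil _
  have h2 : (⌈Real.log t⌉₊ : ℝ) < Real.log t + 1 := Nat.ceil_lt_add_one (by linarith)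
  have h3 := h1.trans (hn _)
  nlinarith

lemma Plane.inner_eq (x y : Plane) : inner ℝ x y = x 0 * y 0 + x 1 * y 1 := by
  rw [PiLp.inner_apply]; simp [mul_comm]

lemma Rect_eq_preimage (a b : ℝ) :
    Rect a b = (@WithLp.ofLp 2 (Fin 2 → ℝ)) ⁻¹'
      Set.pi Set.univ (fun i => Set.Icc (-(![a, b] i)) (![a, b] i)) := by
  ext x; simp [Rect, abs_le, Set.mem_pi, Fin.forall_fin_two, -Set.pi_univ_Icc]

lemma measurableSet_Rect (a b : ℝ) : MeasurableSet (Rect a b) := by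
  rw [Rect_eq_preimage]
  exact (PiLp.volume_preserving_ofLp (Fin 2)).measurable
    (MeasurableSet.univ_pi fun i => measurableSet_Icc)

lemma volume_Rect (a b : ℝ) (ha : 0 ≤ a) : volume (Rect a b) = ENNReal.ofReal (4 * (a * b)) := by
  rw [Rect_eq_preimage, (PiLp.volume_preserving_ofLp (Fin 2)).measure_preimage
    (MeasurableSet.univ_pi fun i => measurableSet_Icc).nullMeasurableSet, volume_pi_pi,
    Fin.prod_univ_two, Real.volume_Icc, Real.volume_Icc, ← ENNReal.ofReal_mul (by simp; linarith)]
  congr 1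
  simp
  ring

lemma convex_Rect (a b : ℝ) : Convex ℝ (Rect a b) := by
  rw [Rect_eq_preimage]
  exact (convex_pi fun i _ => convex_Icc _ _).is_linear_preimage
    ((WithLp.linearEquiv 2 ℝ (Fin 2 → ℝ)).toLinearMap.isLinear)

/-- A `ℤ`-basis of a plane lattice. -/
def planeBasis (L : Submodule ℤ Plane) [DiscreteTopology L] [IsZLattice ℝ L] :
    Module.Basis (Fin 2) ℤ L :=
  have : Module.Finite ℤ L := ZLattice.module_finite ℝ L
  have : Module.Free ℤ L := ZLattice.module_free ℝ L
  (Module.Free.chooseBasis ℤ L).reindex (Fintype.equivOfCardEq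
    (by rw [← Module.finrank_eq_card_chooseBasisIndex, ZLattice.rank ℝ, finrank_euclideanSpace_fin,
          Fintype.card_fin]))

/-- Every axis-parallel box of large enough area contains a nonzero vector of `M`. -/
def HasBoxVectors (M : Submodule ℤ Plane) : Prop :=
  ∃ K : ℝ, 0 < K ∧ ∀ A B : ℝ, 0 < A → 0 < B → K ≤ A * B →
    ∃ l ∈ M, l ≠ 0 ∧ |l 0| ≤ A ∧ |l 1| ≤ B

lemma hasBoxVectors (L : Submodule ℤ Plane) [DiscreteTopology L] [IsZLattice ℝ L] :
    HasBoxVectors L := by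
  have hpos := ZLattice.covolume_pos L volume
  -- The `+ 1` makes the inequality 4 AB > 4 Covol(L) in Minkowski's theorem strict.
  refine ⟨ZLattice.covolume L + 1, by linarith, fun A B hA hB hAB => ?_⟩
  have fund := ZLattice.isAddFundamentalDomain (planeBasis L) volume
  have hF := ZLattice.covolume_eq_measure_fundamentalDomain L volume fund
  have : Countable L.toAddSubgroup := inferInstanceAs (Countable L)
  obtain ⟨x, hx, hxs⟩ := exists_ne_zero_mem_lattice_of_measure_mul_two_pow_lt_measure
    (L := L.toAddSubgroup) (s := Rect A B) fund (fun x hx => by simpa [Rect] using hx)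
    (convex_Rect A B) (by
      rw [volume_Rect A B hA.le]
      have hfin : volume (ZSpan.fundamentalDomain ((planeBasis L).ofZLatticeBasis ℝ)) ≠ ⊤ :=
        (ZSpan.fundamentalDomain_isBounded _).measure_lt_top.ne
      rw [← ENNReal.ofReal_toReal hfin]
      have : (2 : ENNReal) ^ Module.finrank ℝ Plane = ENNReal.ofReal 4 := by
        rw [finrank_euclideanSpace_fin]; norm_num
      rw [this, ← ENNReal.ofReal_mul ENNReal.toReal_nonneg]
      change ZLattice.covolume L = (volume _).toReal at hF
      rw [← hF]
      exact (ENNReal.ofReal_lt_ofReal_iff (by positivity)).mpr (by linarith))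
  exact ⟨x, x.2, by simpa using hx, hxs⟩

/-- The boxes R⁻ᵏ × K Rᵏ each contain a nonzero lattice vector, of weight at least 1/K². Since R >
K/c, admissibility forces its first coordinate above R⁻ᵏ⁻¹, so different k give different vectors.
About log t of them have norm at most t. -/
lemma Admissible.exists_log_le_latticeSum {M : Submodule ℤ Plane} (hM : Admissible M)
    (hK : HasBoxVectors M) :
    ∃ C : ℝ, 0 < C ∧ ∀ᶠ t : ℝ in atTop, 1 / C * Real.log t ≤ latticeSum M t := by
  classical
  have hM' := hM
  obtain ⟨c, hc, hadm⟩ := hM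
  obtain ⟨K, hK0, hbox⟩ := hK
  set R : ℝ := 1 + K / c with hR
  have hR1 : 1 < R := by have : 0 < K / c := by positivity
                         linarith
  have hR0 : 0 < R := by linarith
  have hlogR : 0 < Real.log R := Real.log_pos hR1
  have hbox' : ∀ k : ℕ, ∃ l ∈ M, l ≠ 0 ∧ |l 0| ≤ (R ^ k)⁻¹ ∧ |l 1| ≤ K * R ^ k := fun k =>
    hbox _ _ (by positivity) (by positivity) (by field_simp; rfl)
  choose l hlM hl0 hlA hlB using hbox'
  have hlow : ∀ k, (R ^ (k + 1))⁻¹ < |l k 0| := by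
    intro k
    have h1 := hadm (l k) (hlM k) (hl0 k)
    rw [abs_mul] at h1
    have h2 : c ≤ |l k 0| * (K * R ^ k) := h1.trans (by gcongr; exact hlB k)
    have h3 : 0 < |l k 0| := abs_pos.mpr (hM'.coord_ne_zero (hlM k) (hl0 k)).1
    rw [inv_lt_iff_one_lt_mul₀ (by positivity), pow_succ, hR]
    have h5 : 0 < |l k 0| * R ^ k := by positivity
    have h4 : 1 ≤ |l k 0| * R ^ k * (K / c) := by
      rw [← mul_div_assoc, le_div_iff₀ hc]; linarith
    rw [← hR]
    nlinarith
  have hinj : ∀ j k, j < k → l j ≠ l k := by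
    intro j k hjk heq
    have h1 := hlow j
    have h2 := hlA k
    rw [← heq] at h2
    have : R ^ (j + 1) ≤ R ^ k := pow_le_pow_right₀ hR1.le hjk
    have : (R ^ k)⁻¹ ≤ (R ^ (j + 1))⁻¹ := by gcongr
    linarith
  have hinj' : Function.Injective l := by
    intro j k h
    rcases lt_trichotomy j k with h' | h' | h'
    · exact absurd h (hinj j k h')
    · exact h'
    · exact absurd h.symm (hinj k j h')
  have hn : ∀ n : ℕ, (n : ℝ) * (1 / K ^ 2) ≤ latticeSum M ((1 + K) * R ^ n) := by
    intro n
    rw [hM'.latticeSum_eq]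
    calc (n : ℝ) * (1 / K ^ 2) = ∑ k ∈ Finset.range n, 1 / K ^ 2 := by simp
      _ ≤ ∑ k ∈ Finset.range n, weight (l k) := by
          refine Finset.sum_le_sum fun k _ => ?_
          obtain ⟨n0, n1⟩ := hM'.coord_ne_zero (hlM k) (hl0 k)
          have : |l k 0 * l k 1| ≤ K := by
            rw [abs_mul]
            refine (mul_le_mul (hlA k) (hlB k) (abs_nonneg _) (by positivity)).trans (le_of_eq ?_)
            field_simp
          unfold weight
          rw [← mul_pow, ← sq_abs (l k 0 * l k 1)]
          have : 0 < |l k 0 * l k 1| := by positivity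
          refine one_div_le_one_div_of_le (by positivity) ?_
          gcongr
      _ = ∑ x ∈ (Finset.range n).image l, weight x := by
          rw [Finset.sum_image hinj'.injOn]
      _ ≤ _ := by
          refine Finset.sum_le_sum_of_subset_of_nonneg (fun x hx => ?_) fun x _ _ => weight_nonneg x
          obtain ⟨k, hk, rfl⟩ := Finset.mem_image.mp hx
          refine hM'.mem_ballFinset.mpr ⟨hlM k, norm_pos_iff.mpr (hl0 k), ?_⟩
          have hk' : R ^ k ≤ R ^ n := pow_le_pow_right₀ hR1.le (Finset.mem_range.mp hk).le
          have h1R : 1 ≤ R ^ k := one_le_pow₀ hR1.le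
          have hsq : ‖l k‖ ^ 2 ≤ ((1 + K) * R ^ k) ^ 2 := by
            rw [Plane.norm_sq, ← sq_abs (l k 0), ← sq_abs (l k 1)]
            have e1 : |l k 0| ≤ R ^ k := (hlA k).trans ((inv_le_one_of_one_le₀ h1R).trans h1R)
            have e2 := hlB k
            calc |l k 0| ^ 2 + |l k 1| ^ 2 ≤ (R ^ k) ^ 2 + (K * R ^ k) ^ 2 := by gcongr
              _ ≤ _ := by nlinarith [mul_pos hK0 (by positivity : 0 < (R ^ k) ^ 2)]
          exact (abs_le_of_sq_le_sq hsq (by positivity) |> le_of_abs_le).trans (by gcongr)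
  -- The factor 2 absorbs the rounding of the number of boxes and the shift by log(1 + K).
  refine ⟨2 * K ^ 2 * Real.log R, by positivity, ?_⟩
  filter_upwards [eventually_ge_atTop (1 + K), Real.tendsto_log_atTop.eventually_ge_atTop
    (2 * (Real.log (1 + K) + Real.log R))] with t ht htlog
  have ht0 : 0 < t := by linarith
  set y := Real.log (t / (1 + K)) / Real.log R with hy
  have hy0 : 0 ≤ y := div_nonneg (Real.log_nonneg (by rw [le_div_iff₀ (by linarith)]; linarith)) hlogR.le
  have h1 : (1 + K) * R ^ ⌊y⌋₊ ≤ t := by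
    have : R ^ ⌊y⌋₊ ≤ t / (1 + K) := by
      rw [← Real.log_le_log_iff (by positivity) (by positivity), Real.log_pow, ← le_div_iff₀ hlogR]
      exact Nat.floor_le hy0
    rw [le_div_iff₀ (by linarith)] at this
    linarith
  have h2 := (hn ⌊y⌋₊).trans (hM'.latticeSum_mono h1)
  have h3 : y < ⌊y⌋₊ + 1 := Nat.lt_floor_add_one y
  refine le_trans ?_ h2
  have h4 : Real.log t / (2 * Real.log R) ≤ ⌊y⌋₊ := by
    have : Real.log t / (2 * Real.log R) ≤ y - 1 := by
      rw [hy, Real.log_div ht0.ne' (by linarith), div_sub_one hlogR.ne',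
        div_le_div_iff₀ (by positivity) hlogR]
      nlinarith
    linarith
  calc _ = Real.log t / (2 * Real.log R) * (1 / K ^ 2) := by field_simp
    _ ≤ _ := by gcongr

/-! ### The dual lattice as a rotated and rescaled copy of the lattice -/

section dual

variable {L : Submodule ℤ Plane} (b : Module.Basis (Fin 2) ℤ L)

/-- The determinant of a pair of basis vectors. -/
def basisDet : ℝ := (b 0 : Plane) 0 * (b 1 : Plane) 1 - (b 0 : Plane) 1 * (b 1 : Plane) 0

/-- If the determinant vanished, the first and the second coordinates would each give a linear
relation between the basis vectors. Independence would then kill both coordinates of `b 0`. -/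
lemma basisDet_ne_zero [DiscreteTopology L] [IsZLattice ℝ L] : basisDet b ≠ 0 := by
  intro h
  unfold basisDet at h
  have hli := (b.ofZLatticeBasis ℝ).linearIndependent
  rw [Fintype.linearIndependent_iff] at hli
  have h1 := hli ![(b 1 : Plane) 1, -(b 0 : Plane) 1] (Plane.ext (by simp; linarith)
    (by simp; ring))
  have h2 := hli ![(b 1 : Plane) 0, -(b 0 : Plane) 0] (Plane.ext (by simp; ring)
    (by simp; linarith))
  have h3 : (b 0 : Plane) = 0 := Plane.ext (by simpa using h2 1) (by simpa using h1 1)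
  exact (b.ofZLatticeBasis ℝ).ne_zero 0 (by simpa using h3)

lemma exists_eq_of_mem {l : Plane} (hl : l ∈ L) :
    ∃ p q : ℤ, ∀ i, l i = p * (b 0 : Plane) i + q * (b 1 : Plane) i := by
  refine ⟨b.repr ⟨l, hl⟩ 0, b.repr ⟨l, hl⟩ 1, fun i => ?_⟩
  have h := b.sum_repr ⟨l, hl⟩
  have h2 := congrArg (fun x : L => (x : Plane) i) h
  simp only [Fin.sum_univ_two] at h2
  rw [← h2]
  simp [← Int.cast_smul_eq_zsmul ℝ]

/-- The dual vector with scalar products `k 0`, `k 1` with the basis vectors. -/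
def dualVec (k : Fin 2 → ℤ) : Plane :=
  !₂[(k 0 * (b 1 : Plane) 1 - k 1 * (b 0 : Plane) 1) / basisDet b,
    (k 1 * (b 0 : Plane) 0 - k 0 * (b 1 : Plane) 0) / basisDet b]

variable [DiscreteTopology L] [IsZLattice ℝ L]

lemma inner_dualVec (k : Fin 2 → ℤ) (i : Fin 2) : inner ℝ (b i : Plane) (dualVec b k) = k i := by
  have h := basisDet_ne_zero b
  rw [Plane.inner_eq]
  fin_cases i <;> simp [dualVec] <;> field_simp <;> unfold basisDet <;> ring

lemma dualVec_mem (k : Fin 2 → ℤ) : dualVec b k ∈ dualLattice L := by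
  intro l hl
  obtain ⟨p, q, h⟩ := exists_eq_of_mem b hl
  refine ⟨p * k 0 + q * k 1, ?_⟩
  have h0 := inner_dualVec b k 0
  have h1 := inner_dualVec b k 1
  rw [Plane.inner_eq] at *
  push_cast
  rw [← h0, ← h1, h 0, h 1]
  ring

lemma exists_dualVec_eq {m : Plane} (hm : m ∈ dualLattice L) : ∃ k, dualVec b k = m := by
  obtain ⟨x, hx⟩ := hm _ (b 0).2
  obtain ⟨y, hy⟩ := hm _ (b 1).2
  have h := basisDet_ne_zero b
  rw [Plane.inner_eq] at hx hy
  refine ⟨![x, y], Plane.ext ?_ ?_⟩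
  · simp only [dualVec, Matrix.cons_val_zero, Matrix.cons_val_one, ← hx, ← hy, PiLp.toLp_apply]
    rw [div_eq_iff h]; unfold basisDet; ring
  · simp only [dualVec, Matrix.cons_val_zero, Matrix.cons_val_one, ← hx, ← hy, PiLp.toLp_apply]
    rw [div_eq_iff h]; unfold basisDet; ring

/-- The dual lattice is parametrized by `ℤ²`. -/
def dualEquiv : (Fin 2 → ℤ) ≃ dualLattice L :=
  Equiv.ofBijective (fun k => ⟨dualVec b k, dualVec_mem b k⟩) <| by
    constructor
    · intro k k' h
      ext i
      have h1 := inner_dualVec b k i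
      have h2 : dualVec b k = dualVec b k' := congrArg Subtype.val h
      rw [h2, inner_dualVec b k' i] at h1
      exact_mod_cast h1.symm
    · rintro ⟨m, hm⟩
      obtain ⟨k, rfl⟩ := exists_dualVec_eq b hm
      exact ⟨k, rfl⟩

/-- In the plane, a quarter turn divided by the determinant maps L into its dual, and the inverse
map comes next. It exchanges the coordinates up to sign and scale, so admissibility and short
vectors in boxes pass to the dual. -/
lemma rotate_mem_dualLattice {l : Plane} (hl : l ∈ L) :
    !₂[-l 1 / basisDet b, l 0 / basisDet b] ∈ dualLattice L := by
  have h := basisDet_ne_zero b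
  obtain ⟨p, q, hpq⟩ := exists_eq_of_mem b hl
  convert dualVec_mem b ![-q, p] using 1
  refine Plane.ext ?_ ?_
  · simp [dualVec, hpq]; try ring
  · simp [dualVec, hpq]; try ring

lemma rotate_mem_of_mem_dualLattice {m : Plane} (hm : m ∈ dualLattice L) :
    !₂[basisDet b * m 1, -(basisDet b * m 0)] ∈ L := by
  have h := basisDet_ne_zero b
  obtain ⟨k, rfl⟩ := exists_dualVec_eq b hm
  have : !₂[basisDet b * (dualVec b k) 1, -(basisDet b * (dualVec b k) 0)]
      = ((k 1 • b 0 - k 0 • b 1 : L) : Plane) := by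
    refine Plane.ext ?_ ?_
    · simp [dualVec, ← Int.cast_smul_eq_zsmul ℝ]; field_simp; try ring
    · simp [dualVec, ← Int.cast_smul_eq_zsmul ℝ]; field_simp; try ring
  rw [this]
  exact Subtype.coe_prop _

lemma Admissible.dual (hL : Admissible L) : Admissible (dualLattice L) := by
  obtain ⟨c, hc, h⟩ := hL
  have hd := basisDet_ne_zero (planeBasis L)
  set d := basisDet (planeBasis L)
  refine ⟨c / d ^ 2, by positivity, fun m hm hm0 => ?_⟩
  have h1 := h _ (rotate_mem_of_mem_dualLattice (planeBasis L) hm) fun h0 => hm0 <| by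
    have e0 := congrArg (fun x : Plane => x 0) h0
    have e1 := congrArg (fun x : Plane => x 1) h0
    refine Plane.ext ?_ ?_ <;> simp_all [d]
  rw [div_le_iff₀ (by positivity)]
  refine h1.trans (le_of_eq ?_)
  change |d * m 1 * -(d * m 0)| = _
  rw [show d * m 1 * -(d * m 0) = -(m 0 * m 1 * d ^ 2) by ring, abs_neg, abs_mul,
    abs_of_nonneg (sq_nonneg d)]

lemma hasBoxVectors_dual : HasBoxVectors (dualLattice L) := by
  obtain ⟨K, hK, h⟩ := hasBoxVectors L
  have hd := basisDet_ne_zero (planeBasis L)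
  set d := basisDet (planeBasis L) with hddef
  have hd0 : 0 < |d| := abs_pos.mpr hd
  refine ⟨K / |d| ^ 2, by positivity, fun A B hA hB hAB => ?_⟩
  rw [div_le_iff₀ (by positivity)] at hAB
  obtain ⟨l, hl, hl0, hlA, hlB⟩ := h (|d| * B) (|d| * A) (by positivity) (by positivity)
    (by linarith)
  refine ⟨_, rotate_mem_dualLattice (planeBasis L) hl, fun h0 => hl0 ?_, ?_, ?_⟩
  · have e0 := congrArg (fun x : Plane => x 0) h0
    have e1 := congrArg (fun x : Plane => x 1) h0
    refine Plane.ext ?_ ?_ <;> simp_all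
  · change |-l 1 / d| ≤ A
    rwa [abs_div, abs_neg, div_le_iff₀ hd0, mul_comm]
  · change |l 0 / d| ≤ B
    rwa [abs_div, div_le_iff₀ hd0, mul_comm]

end dual

lemma Admissible.latticeSum_theta {L : Submodule ℤ Plane} (hL : Admissible L)
    (hK : HasBoxVectors L) :
    ∃ C : ℝ, 0 < C ∧ ∀ᶠ t : ℝ in atTop,
      1 / C * Real.log t ≤ latticeSum L t ∧ latticeSum L t ≤ C * Real.log t := by
  obtain ⟨C₁, hC₁, h₁⟩ := hL.exists_log_le_latticeSum hK
  obtain ⟨C₂, hC₂, h₂⟩ := hL.exists_latticeSum_le_log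
  refine ⟨max C₁ C₂, lt_max_of_lt_left hC₁, ?_⟩
  filter_upwards [h₁, eventually_ge_atTop (Real.exp 1), eventually_ge_atTop 1] with t ht ht2 ht3
  have hlog := Real.log_nonneg ht3
  constructor
  · refine le_trans ?_ ht
    gcongr
    exact le_max_left _ _
  · refine (h₂ t ht2).trans ?_
    gcongr
    exact le_max_right _ _

/-! ### Large sieve and the mean square of the truncated sine sum -/

/-- The Fourier transform of the tent function is controlled by a Cauchy kernel. -/
lemma integral_tent_mul_cos_le {R : ℝ} (hR : 0 < R) (x : ℝ) :
    ∫ t in (0 : ℝ)..R, (1 - t / R) * Real.cos (x * t) ≤ 5 / 2 * R * (1 / (1 + (R * x) ^ 2)) := by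
  rcases eq_or_ne x 0 with rfl | hx
  · have : ∫ t in (0 : ℝ)..R, (1 - t / R) = R / 2 := by
      rw [intervalIntegral.integral_sub (by simp) (by
        apply Continuous.intervalIntegrable; fun_prop), intervalIntegral.integral_div]
      simp
      field_simp
      ring
    simp [this]
    linarith
  · have hd : ∀ t ∈ Set.uIcc 0 R, HasDerivAt
        (fun t => (1 - t / R) * (Real.sin (x * t) / x) - Real.cos (x * t) / (R * x ^ 2))
        ((1 - t / R) * Real.cos (x * t)) t := by
      intro t _
      have hx1 : HasDerivAt (fun t : ℝ => x * t) x t := by simpa using (hasDerivAt_id t).const_mul x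
      have h1 : HasDerivAt (fun t : ℝ => 1 - t / R) (-(1 / R)) t := by
        simpa using ((hasDerivAt_id t).div_const R).const_sub 1
      have := (h1.mul (hx1.sin.div_const x)).sub (hx1.cos.div_const (R * x ^ 2))
      refine this.congr_deriv ?_
      field_simp
      ring
    rw [intervalIntegral.integral_eq_sub_of_hasDerivAt hd
      (by apply Continuous.intervalIntegrable; fun_prop)]
    have e : (1 - R / R) * (Real.sin (x * R) / x) - Real.cos (x * R) / (R * x ^ 2)
        - ((1 - 0 / R) * (Real.sin (x * 0) / x) - Real.cos (x * 0) / (R * x ^ 2))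
        = (1 - Real.cos (R * x)) / (R * x ^ 2) := by
      rw [mul_comm R x]
      simp [hR.ne']
      ring
    rw [e, mul_one_div, div_le_div_iff₀ (by positivity) (by positivity)]
    have h1 := Real.one_sub_sq_div_two_le_cos (x := R * x)
    have h2 := Real.neg_one_le_cos (R * x)
    -- With y = Rx, the bound 1 - cos y ≤ y²/2 serves for the term 1 and 1 - cos y ≤ 2 for the term
    -- y²; together they give 5/2.
    have : (1 - Real.cos (R * x)) * (1 + (R * x) ^ 2) ≤ 5 / 2 * (R * x) ^ 2 := by
      nlinarith [sq_nonneg (R * x)]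
    nlinarith

/-- A large sieve bound for the mean square of a cosine sum with nonnegative coefficients. -/
lemma integral_sq_sum_cos_le {ι : Type*} (S : Finset ι) (w μ : ι → ℝ) (hw : ∀ i ∈ S, 0 ≤ w i)
    {T B : ℝ} (hT : 0 < T)
    (hB : ∀ i ∈ S, ∑ j ∈ S, w j * (1 / (1 + (T * (μ j - μ i)) ^ 2)) ≤ B) :
    ∫ t in (0 : ℝ)..T, (∑ i ∈ S, w i * Real.cos (μ i * t)) ^ 2 ≤ 10 * T * B * ∑ i ∈ S, w i := by
  -- Adding the square of the sine sum gives the squared modulus of an exponential sum, in which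
  -- only frequency differences occur.
  have hpt : ∀ t, (∑ i ∈ S, w i * Real.cos (μ i * t)) ^ 2
      ≤ ∑ i ∈ S, ∑ j ∈ S, w i * w j * Real.cos ((μ j - μ i) * t) := by
    intro t
    have : ∑ i ∈ S, ∑ j ∈ S, w i * w j * Real.cos ((μ j - μ i) * t)
        = (∑ i ∈ S, w i * Real.cos (μ i * t)) ^ 2 + (∑ i ∈ S, w i * Real.sin (μ i * t)) ^ 2 := by
      rw [sq, sq, Finset.sum_mul_sum, Finset.sum_mul_sum, ← Finset.sum_add_distrib]
      refine Finset.sum_congr rfl fun i _ => ?_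
      rw [← Finset.sum_add_distrib]
      refine Finset.sum_congr rfl fun j _ => ?_
      rw [sub_mul, Real.cos_sub]
      ring
    rw [this]
    linarith [sq_nonneg (∑ i ∈ S, w i * Real.sin (μ i * t))]
  set P : ℝ → ℝ := fun t => ∑ i ∈ S, ∑ j ∈ S, w i * w j * Real.cos ((μ j - μ i) * t) with hP
  have hPc : Continuous P := by fun_prop
  have hQc : Continuous fun t => (∑ i ∈ S, w i * Real.cos (μ i * t)) ^ 2 := by fun_prop
  have hP0 : ∀ t, 0 ≤ P t := fun t => (sq_nonneg _).trans (hpt t)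
  -- Twice the tent of length 2T is at least 1 on [0, T] and nonnegative on [T, 2T]. As the products
  -- w i * w j are nonnegative, an upper bound for its cosine transform suffices term by term.
  have hR : 0 < 2 * T := by linarith
  have hFc : Continuous fun t => 2 * ((1 - t / (2 * T)) * P t) := by fun_prop
  calc ∫ t in (0 : ℝ)..T, (∑ i ∈ S, w i * Real.cos (μ i * t)) ^ 2
      ≤ ∫ t in (0 : ℝ)..T, 2 * ((1 - t / (2 * T)) * P t) := by
        refine intervalIntegral.integral_mono_on hT.le (hQc.intervalIntegrable _ _)
          (hFc.intervalIntegrable _ _) fun t ht => (hpt t).trans ?_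
        have h1 : t / (2 * T) ≤ 1 / 2 := by
          rw [div_le_div_iff₀ hR two_pos]; linarith [ht.2]
        have := hP0 t
        change P t ≤ _
        nlinarith
    _ ≤ ∫ t in (0 : ℝ)..(2 * T), 2 * ((1 - t / (2 * T)) * P t) := by
        rw [← intervalIntegral.integral_add_adjacent_intervals (b := T) (c := 2 * T)
          (hFc.intervalIntegrable _ _) (hFc.intervalIntegrable _ _)]
        refine le_add_of_nonneg_right
          (intervalIntegral.integral_nonneg (by linarith) fun t ht => ?_)
        have h1 : t / (2 * T) ≤ 1 := by rw [div_le_one hR]; exact ht.2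
        exact mul_nonneg two_pos.le (mul_nonneg (by linarith) (hP0 t))
    _ = 2 * ∑ i ∈ S, ∑ j ∈ S, w i * w j *
          ∫ t in (0 : ℝ)..(2 * T), (1 - t / (2 * T)) * Real.cos ((μ j - μ i) * t) := by
        rw [intervalIntegral.integral_const_mul]
        congr 1
        simp only [hP, Finset.mul_sum]
        rw [intervalIntegral.integral_finsetSum fun i _ =>
          Continuous.intervalIntegrable (by fun_prop) _ _]
        refine Finset.sum_congr rfl fun i _ => ?_
        rw [intervalIntegral.integral_finsetSum fun i _ =>
          Continuous.intervalIntegrable (by fun_prop) _ _]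
        refine Finset.sum_congr rfl fun j _ => ?_
        rw [← intervalIntegral.integral_const_mul]
        refine intervalIntegral.integral_congr fun t _ => ?_
        ring
    _ ≤ 2 * ∑ i ∈ S, ∑ j ∈ S, w i * w j * (5 * T * (1 / (1 + (T * (μ j - μ i)) ^ 2))) := by
        gcongr with i hi j hj
        · exact mul_nonneg (hw i hi) (hw j hj)
        · refine (integral_tent_mul_cos_le hR _).trans ?_
          rw [show 5 / 2 * (2 * T) = 5 * T by ring]
          have : (T * (μ j - μ i)) ^ 2 ≤ (2 * T * (μ j - μ i)) ^ 2 := by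
            nlinarith [sq_nonneg (T * (μ j - μ i))]
          gcongr
    _ = 10 * T * ∑ i ∈ S, w i * ∑ j ∈ S, w j * (1 / (1 + (T * (μ j - μ i)) ^ 2)) := by
        simp only [Finset.mul_sum]
        refine Finset.sum_congr rfl fun i _ => Finset.sum_congr rfl fun j _ => ?_
        ring
    _ ≤ 10 * T * ∑ i ∈ S, w i * B := by
        gcongr with i hi
        · exact hw i hi
        · exact hB i hi
    _ = _ := by rw [← Finset.sum_mul]; ring

/-- If |l₀| ≥ 1, the weight is at most l₁⁻² as well as c⁻²; otherwise the kernel in l₀ is at least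
1/2. A weight thus supplies the second Cauchy factor needed by `exists_sum_forms_le`. -/
lemma Admissible.exists_weight_le {M : Submodule ℤ Plane} (hM : Admissible M) :
    ∃ A : ℝ, 0 < A ∧ ∀ l ∈ M, l ≠ 0 →
      weight l ≤ A ∧ weight l ≤ A * (1 / (1 + l 0 ^ 2) + 1 / (1 + l 1 ^ 2)) := by
  have hM' := hM
  obtain ⟨c, hc, hadm⟩ := hM
  refine ⟨1 + 2 / c ^ 2, by positivity, fun l hl h0 => ?_⟩
  obtain ⟨n0, n1⟩ := hM'.coord_ne_zero hl h0
  have hw : weight l ≤ 1 / c ^ 2 := by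
    unfold weight
    rw [← mul_pow, ← sq_abs (l 0 * l 1)]
    have := hadm l hl h0
    gcongr
  have hw0 := weight_nonneg l
  have hc2 : 0 ≤ 1 / c ^ 2 := by positivity
  have e : (2 : ℝ) / c ^ 2 = 1 / c ^ 2 + 1 / c ^ 2 := by ring
  refine ⟨by rw [e]; linarith, ?_⟩
  have p0 : 0 < 1 / (1 + l 0 ^ 2) := by positivity
  have p1 : 0 < 1 / (1 + l 1 ^ 2) := by positivity
  have pA : 0 ≤ 1 + 2 / c ^ 2 := by positivity
  have hwm : weight l * (l 0 ^ 2 * l 1 ^ 2) = 1 := by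
    unfold weight; field_simp
  by_cases h : 1 ≤ l 0 ^ 2
  · have : weight l ≤ (1 + 2 / c ^ 2) * (1 / (1 + l 1 ^ 2)) := by
      rw [mul_one_div, le_div_iff₀ (by positivity), e]
      nlinarith [mul_le_mul_of_nonneg_left h (mul_nonneg hw0 (sq_nonneg (l 1)))]
    refine this.trans ?_
    gcongr
    linarith
  · have : weight l ≤ (1 + 2 / c ^ 2) * (1 / (1 + l 0 ^ 2)) := by
      rw [mul_one_div, le_div_iff₀ (by positivity), e]
      nlinarith
    refine this.trans ?_
    gcongr
    linarith

/-- The local weight of the frequencies `p l₀ + q l₁` is bounded. -/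
lemma Admissible.exists_frequency_mass_le {M : Submodule ℤ Plane} (hM : Admissible M) {p q : ℝ}
    (hpq : p ≠ 0 ∨ q ≠ 0) :
    ∃ B : ℝ, 0 < B ∧ ∀ T μ : ℝ, 1 ≤ T →
      ∑ l ∈ ballFinset M T, weight l * (1 / (1 + (T * (p * l 0 + q * l 1 - μ)) ^ 2)) ≤ B := by
  obtain ⟨A, hA, hw⟩ := hM.exists_weight_le
  have hS : ∀ T, ∀ l ∈ ballFinset M T, l ∈ M := fun T l hl => (hM.mem_ballFinset.mp hl).1
  have hw' : ∀ T, ∀ l ∈ ballFinset M T,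
      weight l ≤ A ∧ weight l ≤ A * (1 / (1 + l 0 ^ 2) + 1 / (1 + l 1 ^ 2)) := fun T l hl =>
    hw l (hS T l hl) (norm_pos_iff.mp (hM.mem_ballFinset.mp hl).2.1)
  have hsq : ∀ T, 1 ≤ T → ∀ l ∈ ballFinset M T, ∀ i : Fin 2, 1 + (T⁻¹ * l i) ^ 2 ≤ 2 := by
    intro T hT l hl i
    have hT0 : 0 < T := by linarith
    have h1 : |l i| ≤ T := by
      have := Plane.abs_coord_le l
      have h2 := (hM.mem_ballFinset.mp hl).2.2
      fin_cases i
      · exact this.1.trans h2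
      · exact this.2.trans h2
    have : (T⁻¹ * l i) ^ 2 ≤ 1 := by
      rw [sq_le_one_iff_abs_le_one, abs_mul, abs_of_pos (inv_pos.mpr hT0), inv_mul_le_iff₀ hT0]
      linarith
    linarith
  -- When the frequency depends on one coordinate only, the second form is the other coordinate
  -- divided by T; its kernel is at least 1/2 on the ball of radius T. This compensates for the
  -- dilation of the frequency by T.
  by_cases hp : p = 0
  · have hq : q ≠ 0 := hpq.resolve_left (not_not.mpr hp)
    obtain ⟨C, hC, h⟩ := hM.exists_sum_forms_le (1 / |q|)
    refine ⟨2 * A * C, by positivity, fun T μ hT => ?_⟩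
    have hT0 : 0 < T := by linarith
    have key := h T⁻¹ 0 0 (T * q) 0 (T * μ) (by simp [hT0.ne', hq]) (by
      rw [← sq_abs (_ - _)]
      simp [abs_mul, abs_of_pos hT0]
      field_simp; rfl) _ (hS T)
    calc _ ≤ ∑ l ∈ ballFinset M T, 2 * A * (1 / (1 + (T⁻¹ * l 0 + 0 * l 1 - 0) ^ 2) *
            (1 / (1 + (0 * l 0 + T * q * l 1 - T * μ) ^ 2))) := by
          refine Finset.sum_le_sum fun l hl => ?_
          have e1 : T * (p * l 0 + q * l 1 - μ) = 0 * l 0 + T * q * l 1 - T * μ := by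
            rw [hp]; ring
          rw [e1, ← mul_assoc]
          gcongr
          refine (hw' T l hl).1.trans ?_
          rw [mul_one_div, le_div_iff₀ (by positivity)]
          have := hsq T hT l hl 0
          rw [show T⁻¹ * l 0 + 0 * l 1 - 0 = T⁻¹ * l 0 by ring]
          nlinarith
      _ ≤ _ := by rw [← Finset.mul_sum]; gcongr
  by_cases hq : q = 0
  · obtain ⟨C, hC, h⟩ := hM.exists_sum_forms_le (1 / |p|)
    refine ⟨2 * A * C, by positivity, fun T μ hT => ?_⟩
    have hT0 : 0 < T := by linarith
    have key := h 0 T⁻¹ (T * p) 0 0 (T * μ) (by simp [hT0.ne', hp]) (by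
      rw [← sq_abs (_ - _)]
      simp [abs_mul, abs_of_pos hT0]
      field_simp; rfl) _ (hS T)
    calc _ ≤ ∑ l ∈ ballFinset M T, 2 * A * (1 / (1 + (0 * l 0 + T⁻¹ * l 1 - 0) ^ 2) *
            (1 / (1 + (T * p * l 0 + 0 * l 1 - T * μ) ^ 2))) := by
          refine Finset.sum_le_sum fun l hl => ?_
          have e1 : T * (p * l 0 + q * l 1 - μ) = T * p * l 0 + 0 * l 1 - T * μ := by
            rw [hq]; ring
          rw [e1, ← mul_assoc]
          gcongr
          refine (hw' T l hl).1.trans ?_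
          rw [mul_one_div, le_div_iff₀ (by positivity)]
          have := hsq T hT l hl 1
          rw [show 0 * l 0 + T⁻¹ * l 1 - 0 = T⁻¹ * l 1 by ring]
          nlinarith
      _ ≤ _ := by rw [← Finset.mul_sum]; gcongr
  -- Here either coordinate is independent of the frequency, so the kernel supplied by the weight
  -- serves as second factor. Dropping the dilation by T ≥ 1 only enlarges the other kernel.
  · obtain ⟨C, hC, h⟩ := hM.exists_sum_forms_le
      ((1 + |p|) / |q| + (1 + |q|) / |p|)
    have hp0 : 0 < |p| := abs_pos.mpr hp
    have hq0 : 0 < |q| := abs_pos.mpr hq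
    refine ⟨A * (C + C), by positivity, fun T μ hT => ?_⟩
    have key0 := h 1 0 p q 0 μ (by simpa using hq) (by
      rw [← sq_abs (_ - _)]
      have : 0 ≤ (1 + |q|) / |p| * |q| ^ 2 := by positivity
      have e : (1 + |p|) / |q| * |q| ^ 2 = |q| * (1 + |p|) := by field_simp
      simp only [abs_zero, abs_one, one_mul, zero_mul, sub_zero, add_zero]
      linarith) _ (hS T)
    have key1 := h 0 1 p q 0 μ (by simpa using hp) (by
      rw [← sq_abs (_ - _)]
      have : 0 ≤ (1 + |p|) / |q| * |p| ^ 2 := by positivity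
      have e : (1 + |q|) / |p| * |p| ^ 2 = (|q| + 1) * |p| := by field_simp; ring
      simp only [abs_zero, abs_one, one_mul, zero_mul, zero_sub, zero_add, abs_neg]
      linarith) _ (hS T)
    calc _ ≤ ∑ l ∈ ballFinset M T, A * (1 / (1 + (1 * l 0 + 0 * l 1 - 0) ^ 2) *
              (1 / (1 + (p * l 0 + q * l 1 - μ) ^ 2)) + 1 / (1 + (0 * l 0 + 1 * l 1 - 0) ^ 2) *
              (1 / (1 + (p * l 0 + q * l 1 - μ) ^ 2))) := by
          refine Finset.sum_le_sum fun l hl => ?_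
          rw [← add_mul, ← mul_assoc]
          have e := (hw' T l hl).2
          have e2 : 1 / (1 + (T * (p * l 0 + q * l 1 - μ)) ^ 2)
              ≤ 1 / (1 + (p * l 0 + q * l 1 - μ) ^ 2) := by
            have : 1 ≤ T ^ 2 := one_le_pow₀ hT
            rw [mul_pow]
            gcongr
            exact le_mul_of_one_le_left (sq_nonneg _) this
          refine mul_le_mul ?_ e2 (by positivity) (by positivity)
          simpa using e
      _ ≤ _ := by
          rw [← Finset.mul_sum, Finset.sum_add_distrib]
          gcongr

lemma Admissible.exists_cos_moment_le {M : Submodule ℤ Plane} (hM : Admissible M) {p q : ℝ}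
    (hpq : p ≠ 0 ∨ q ≠ 0) :
    ∃ B : ℝ, 0 < B ∧ ∀ T : ℝ, 1 ≤ T →
      ∫ t in (0 : ℝ)..T, (∑ l ∈ ballFinset M T, weight l * Real.cos ((p * l 0 + q * l 1) * t)) ^ 2
        ≤ B * T * latticeSum M T := by
  obtain ⟨B, hB, h⟩ := hM.exists_frequency_mass_le hpq
  refine ⟨10 * B, by positivity, fun T hT => ?_⟩
  have := integral_sq_sum_cos_le (ballFinset M T) weight (fun l => p * l 0 + q * l 1)
    (fun l _ => weight_nonneg l) (by linarith : 0 < T) (fun l _ => h T _ hT)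
  rw [hM.latticeSum_eq]
  linarith

/-- The sum of `sin² sin² / (l₀² l₁²)` over the frequencies up to `T`. -/
def sineSum (M : Submodule ℤ Plane) (α β T t : ℝ) : ℝ :=
  ∑ l ∈ ballFinset M T, weight l * (Real.sin (α * t * l 0) ^ 2 * Real.sin (β * t * l 1) ^ 2)

lemma Admissible.exists_sineSum_moment_le {M : Submodule ℤ Plane} (hM : Admissible M) {α β : ℝ}
    (hα : α ≠ 0) (hβ : β ≠ 0) :
    ∃ B : ℝ, 0 < B ∧ ∀ T : ℝ, 1 ≤ T →
      ∫ t in (0 : ℝ)..T, (sineSum M α β T t - latticeSum M T / 4) ^ 2 ≤ B * T * latticeSum M T := by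
  have hα2 : 2 * α ≠ 0 := by simpa using hα
  have hβ2 : 2 * β ≠ 0 := by simpa using hβ
  obtain ⟨B₁, hB₁, h₁⟩ := hM.exists_cos_moment_le (p := 2 * α) (q := 0) (.inl hα2)
  obtain ⟨B₂, hB₂, h₂⟩ := hM.exists_cos_moment_le (p := 0) (q := 2 * β) (.inr hβ2)
  obtain ⟨B₃, hB₃, h₃⟩ := hM.exists_cos_moment_le (p := 2 * α) (q := 2 * β) (.inl hα2)
  obtain ⟨B₄, hB₄, h₄⟩ := hM.exists_cos_moment_le (p := 2 * α) (q := -(2 * β)) (.inl hα2)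
  refine ⟨B₁ + B₂ + B₃ + B₄, by positivity, fun T hT => ?_⟩
  set E : ℝ → ℝ → ℝ → ℝ := fun p q t =>
    ∑ l ∈ ballFinset M T, weight l * Real.cos ((p * l 0 + q * l 1) * t) with hE
  have hEc : ∀ p q, Continuous (E p q) := fun p q => by fun_prop
  -- Expanding (1 - cos 2x)(1 - cos 2y)/4 isolates the mean value 1/4. All four remaining frequency
  -- forms are nonzero.
  have hid : ∀ t, sineSum M α β T t - latticeSum M T / 4
      = -(1 / 4) * E (2 * α) 0 t - 1 / 4 * E 0 (2 * β) t + 1 / 8 * E (2 * α) (2 * β) t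
        + 1 / 8 * E (2 * α) (-(2 * β)) t := by
    intro t
    rw [sineSum, hM.latticeSum_eq, Finset.sum_div, ← Finset.sum_sub_distrib]
    simp only [hE, Finset.mul_sum]
    rw [← Finset.sum_sub_distrib, ← Finset.sum_add_distrib, ← Finset.sum_add_distrib]
    refine Finset.sum_congr rfl fun l _ => ?_
    rw [Real.sin_sq_eq_half_sub, Real.sin_sq_eq_half_sub,
      show (2 * α * l 0 + 0 * l 1) * t = 2 * (α * t * l 0) by ring,
      show (0 * l 0 + 2 * β * l 1) * t = 2 * (β * t * l 1) by ring,
      show (2 * α * l 0 + 2 * β * l 1) * t = 2 * (α * t * l 0) + 2 * (β * t * l 1) by ring,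
      show (2 * α * l 0 + -(2 * β) * l 1) * t = 2 * (α * t * l 0) - 2 * (β * t * l 1) by ring,
      Real.cos_add, Real.cos_sub]
    ring
  have hpt : ∀ t, (sineSum M α β T t - latticeSum M T / 4) ^ 2 ≤
      E (2 * α) 0 t ^ 2 + E 0 (2 * β) t ^ 2 + E (2 * α) (2 * β) t ^ 2
        + E (2 * α) (-(2 * β)) t ^ 2 := by
    intro t
    rw [hid t]
    generalize E (2 * α) 0 t = x
    generalize E 0 (2 * β) t = y
    generalize E (2 * α) (2 * β) t = z
    generalize E (2 * α) (-(2 * β)) t = w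
    -- Cauchy-Schwarz: the squares of the four coefficients sum to less than 1.
    nlinarith [sq_nonneg (x - y), sq_nonneg (x + z), sq_nonneg (x + w), sq_nonneg (y + z),
      sq_nonneg (y + w), sq_nonneg (z - w), sq_nonneg x, sq_nonneg y, sq_nonneg z, sq_nonneg w]
  have hc : Continuous fun t => (sineSum M α β T t - latticeSum M T / 4) ^ 2 := by
    unfold sineSum; fun_prop
  have hi : ∀ p q, IntervalIntegrable (fun t => E p q t ^ 2) volume 0 T := fun p q =>
    ((hEc p q).pow 2).intervalIntegrable _ _
  calc _ ≤ ∫ t in (0 : ℝ)..T, (E (2 * α) 0 t ^ 2 + E 0 (2 * β) t ^ 2 + E (2 * α) (2 * β) t ^ 2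
        + E (2 * α) (-(2 * β)) t ^ 2) :=
        intervalIntegral.integral_mono_on (by linarith) (hc.intervalIntegrable _ _)
          ((((hi _ _).add (hi _ _)).add (hi _ _)).add (hi _ _)) fun t _ => hpt t
    _ = _ := by
        rw [intervalIntegral.integral_add (((hi _ _).add (hi _ _)).add (hi _ _)) (hi _ _),
          intervalIntegral.integral_add ((hi _ _).add (hi _ _)) (hi _ _),
          intervalIntegral.integral_add (hi _ _) (hi _ _)]
    _ ≤ _ := by
        have := h₁ T hT
        have := h₂ T hT
        have := h₃ T hT
        have := h₄ T hT
        simp only [hE]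
        linarith

/-! ### Parseval on the unit square and the point count as a periodization -/

section counting

section torus

local instance : MeasureSpace UnitAddCircle := ⟨AddCircle.haarAddCircle⟩

local instance : Measure.IsAddHaarMeasure (volume : Measure UnitAddCircle) :=
  inferInstanceAs (Measure.IsAddHaarMeasure AddCircle.haarAddCircle)

local instance : IsProbabilityMeasure (volume : Measure UnitAddCircle) :=
  inferInstanceAs (IsProbabilityMeasure AddCircle.haarAddCircle)

/-- The half-open unit square. -/
def unitBox : Set (Fin 2 → ℝ) := {u | ∀ i, u i ∈ Set.Ioc (0 : ℝ) 1}

/-- The integral of a function on the unit square against a character. -/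
def boxCoeff (f : (Fin 2 → ℝ) → ℂ) (k : Fin 2 → ℤ) : ℂ :=
  ∫ u in unitBox, Complex.exp (-(2 * Real.pi * Complex.I * (k 0 * u 0 + k 1 * u 1))) * f u

/-- Parseval's formula on the unit square. -/
lemma hasSum_sq_boxCoeff {f : (Fin 2 → ℝ) → ℂ} (hf : Measurable f) {C : ℝ}
    (hC : ∀ u, ‖f u‖ ≤ C) :
    HasSum (fun k : Fin 2 → ℤ => ‖boxCoeff f k‖ ^ 2) (∫ u in unitBox, ‖f u‖ ^ 2) := by
  set F : UnitAddTorus (Fin 2) → ℂ :=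
    fun x => f (UnitAddTorus.measurableEquivPiIoc (0 : Fin 2 → ℝ) x).1 with hF
  have hbox : {u : Fin 2 → ℝ | ∀ i, u i ∈ Set.Ioc ((0 : Fin 2 → ℝ) i) ((0 : Fin 2 → ℝ) i + 1)}
      = unitBox := by simp [unitBox]
  have hmeas : MeasurableSet unitBox := by
    rw [← hbox]; exact MeasurableSet.univ_pi' fun i => measurableSet_Ioc
  have hval : ∀ u ∈ unitBox, F (fun i => (u i : UnitAddCircle)) = f u := by
    intro u hu
    have hu' : ∀ i, u i ∈ Set.Ioc ((0 : Fin 2 → ℝ) i) ((0 : Fin 2 → ℝ) i + 1) := by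
      simpa [unitBox] using hu
    have := (UnitAddTorus.measurableEquivPiIoc (0 : Fin 2 → ℝ)).apply_symm_apply ⟨u, hu'⟩
    rw [UnitAddTorus.coe_symm_measurableEquivPiIoc_apply] at this
    simp only [hF]
    rw [this]
  have hFm : Measurable F := hf.comp (measurable_subtype_coe.comp
    (UnitAddTorus.measurableEquivPiIoc (0 : Fin 2 → ℝ)).measurable)
  have hLp : MemLp F 2 (volume : Measure (UnitAddTorus (Fin 2))) :=
    MemLp.of_bound hFm.aestronglyMeasurable C (Eventually.of_forall fun x => hC _)
  have h := UnitAddTorus.hasSum_sq_mFourierCoeff (hLp.toLp F)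
  have hint : ∫ x : UnitAddTorus (Fin 2), ‖hLp.toLp F x‖ ^ 2 = ∫ u in unitBox, ‖f u‖ ^ 2 := by
    rw [← hbox, integral_congr_ae (g := fun x => ‖F x‖ ^ 2)
      (hLp.coeFn_toLp.mono fun x hx => by simp only [hx]),
      UnitAddTorus.integral_preimage _ (0 : Fin 2 → ℝ), hbox]
    exact setIntegral_congr_fun hmeas fun u hu => by simp only [hval u hu]
  have hcoef : ∀ k, UnitAddTorus.mFourierCoeff (hLp.toLp F) k = boxCoeff f k := by
    intro k
    have : UnitAddTorus.mFourierCoeff (hLp.toLp F) k = UnitAddTorus.mFourierCoeff F k :=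
      integral_congr_ae (hLp.coeFn_toLp.mono fun x hx => by simp only [hx])
    rw [this, UnitAddTorus.mFourierCoeff_eq_integral F k 0, hbox, boxCoeff]
    refine setIntegral_congr_fun hmeas fun u hu => ?_
    simp only [hval u hu, UnitAddTorus.mFourier, ContinuousMap.coe_mk, Fin.prod_univ_two,
      fourier_coe_apply, smul_eq_mul, ← Complex.exp_add]
    congr 2
    push_cast [Pi.neg_apply]
    ring
  simpa only [hint, hcoef] using h

end torus

/-- A set all of whose finite subsets have at most `n` elements is finite. -/
lemma Set.finite_and_ncard_le_of_forall_finset {α : Type*} {s : Set α} {n : ℕ}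
    (h : ∀ S : Finset α, ↑S ⊆ s → S.card ≤ n) : s.Finite ∧ s.ncard ≤ n := by
  have hfin : s.Finite := by
    by_contra hinf
    obtain ⟨S, hS, hcard⟩ := Set.Infinite.exists_subset_card_eq hinf (n + 1)
    have := h S hS
    omega
  refine ⟨hfin, ?_⟩
  rw [Set.ncard_eq_toFinset_card s hfin]
  exact h _ (by simp)

lemma mem_dilateTranslate_Rect {t a b : ℝ} (ht : 0 < t) {X y : Plane} :
    y ∈ dilateTranslate t (Rect a b) X ↔ y - X ∈ Rect (t * a) (t * b) := by
  constructor
  · rintro ⟨x, hx, rfl⟩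
    simp only [Rect, Set.mem_ofPred_eq, add_sub_cancel_right, PiLp.smul_apply, smul_eq_mul, abs_mul,
      abs_of_pos ht] at hx ⊢
    exact ⟨by gcongr; exact hx.1, by gcongr; exact hx.2⟩
  · intro h
    refine ⟨t⁻¹ • (y - X), ?_, by simp [smul_smul, ht.ne']⟩
    simp only [Rect, Set.mem_ofPred_eq, PiLp.smul_apply, smul_eq_mul, abs_mul,
      abs_of_pos (inv_pos.mpr ht)] at h ⊢
    rwa [inv_mul_le_iff₀ ht, inv_mul_le_iff₀ ht]

variable {L : Submodule ℤ Plane}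

/-- Lattice points in the rectangle have Cauchy mass around X bounded below, while the total mass is
bounded uniformly in X. -/
lemma Admissible.exists_pointCount_le (hL : Admissible L) {t : ℝ} (ht : 0 < t) (a b : ℝ) :
    ∃ n : ℕ, ∀ X, (dilateTranslate t (Rect a b) X ∩ (L : Set Plane)).Finite ∧
      pointCount t (Rect a b) X L ≤ n := by
  obtain ⟨C, hC, h⟩ := hL.exists_sum_forms_le 1
  refine ⟨⌊C * ((1 + (t * a) ^ 2) * (1 + (t * b) ^ 2))⌋₊, fun X =>
    Set.finite_and_ncard_le_of_forall_finset fun S hS => Nat.le_floor ?_⟩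
  have h1 := h 1 0 0 1 (X 0) (X 1) (by norm_num) (by norm_num) S fun l hl => (hS hl).2
  have h2 : ∑ l ∈ S, 1 / ((1 + (t * a) ^ 2) * (1 + (t * b) ^ 2)) ≤ ∑ l ∈ S,
      1 / (1 + (1 * l 0 + 0 * l 1 - X 0) ^ 2) * (1 / (1 + (0 * l 0 + 1 * l 1 - X 1) ^ 2)) := by
    refine Finset.sum_le_sum fun l hl => ?_
    have hmem := (mem_dilateTranslate_Rect ht).mp (hS hl).1
    simp only [Rect, Set.mem_ofPred_eq, PiLp.sub_apply] at hmem
    rw [div_mul_div_comm, one_mul, one_mul, one_mul, zero_mul, zero_mul, add_zero, zero_add]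
    have e0 : (l 0 - X 0) ^ 2 ≤ (t * a) ^ 2 := by rw [← sq_abs]; gcongr; exact hmem.1
    have e1 : (l 1 - X 1) ^ 2 ≤ (t * b) ^ 2 := by rw [← sq_abs]; gcongr; exact hmem.2
    gcongr
  rw [Finset.sum_const, nsmul_eq_mul, mul_one_div] at h2
  have h3 := h2.trans h1
  rwa [div_le_iff₀ (by positivity)] at h3

/-- The central symmetry of the rectangle allows l - X to be replaced by -l + X, and l ↦ -l permutes
L. The periodized form is the one that unfolding requires. -/
lemma Admissible.pointCount_eq_tsum (hL : Admissible L) {t : ℝ} (ht : 0 < t) (a b : ℝ) (X : Plane) :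
    (pointCount t (Rect a b) X L : ENNReal)
      = ∑' l : L, (Rect (t * a) (t * b)).indicator (fun _ => (1 : ENNReal)) ((l : Plane) + X) := by
  obtain ⟨n, hn⟩ := hL.exists_pointCount_le ht a b
  set s : Set L := {l | (l : Plane) - X ∈ Rect (t * a) (t * b)} with hs
  have himg : dilateTranslate t (Rect a b) X ∩ (L : Set Plane) = Subtype.val '' s := by
    ext y
    rw [Set.mem_inter_iff, mem_dilateTranslate_Rect ht]
    simp [hs, and_comm]
  have h1 : (pointCount t (Rect a b) X L : ENat) = s.encard := by
    rw [pointCount, (hn X).1.cast_ncard_eq, himg, Subtype.val_injective.encard_image]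
  rw [← (Equiv.neg L).tsum_eq]
  calc (pointCount t (Rect a b) X L : ENNReal) = ((s.encard : ENat) : ENNReal) := by
        rw [← h1]; simp
    _ = ∑' l : L, s.indicator (fun _ => (1 : ENNReal)) l := by
        rw [← ENNReal.tsum_set_one]; exact tsum_subtype s fun _ => 1
    _ = _ := by
        refine tsum_congr fun l => ?_
        have : ((Equiv.neg L l : L) : Plane) + X ∈ Rect (t * a) (t * b) ↔ l ∈ s := by
          simp only [hs, Rect, Set.mem_ofPred_eq, Equiv.neg_apply, NegMemClass.coe_neg,
            PiLp.add_apply, PiLp.sub_apply, PiLp.neg_apply]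
          rw [abs_sub_comm ((l : Plane) 0), abs_sub_comm ((l : Plane) 1), neg_add_eq_sub,
            neg_add_eq_sub]
        by_cases h : l ∈ s
        · rw [Set.indicator_of_mem h, Set.indicator_of_mem (this.mpr h)]
        · rw [Set.indicator_of_notMem h, Set.indicator_of_notMem (mt this.mp h)]

lemma Admissible.measurable_pointCount (hL : Admissible L) [Countable L] {t : ℝ} (ht : 0 < t)
    (a b : ℝ) : Measurable fun X => (pointCount t (Rect a b) X L : ℝ) := by
  have h : ∀ X, (pointCount t (Rect a b) X L : ℝ) = (∑' l : L, (Rect (t * a) (t * b)).indicator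
      (fun _ => (1 : ENNReal)) ((l : Plane) + X)).toReal := fun X => by
    rw [← hL.pointCount_eq_tsum ht]; simp
  simp only [h]
  refine (Measurable.tsum fun l => ?_).ennreal_toReal
  exact (measurable_const.indicator (measurableSet_Rect _ _)).comp (measurable_const_add _)

lemma Admissible.hasSum_pointCount (hL : Admissible L) {t : ℝ} (ht : 0 < t) (a b : ℝ) (X : Plane) :
    HasSum (fun l : L => (Rect (t * a) (t * b)).indicator (fun _ => (1 : ℂ)) ((l : Plane) + X))
      (pointCount t (Rect a b) X L : ℂ) := by
  have h := hL.pointCount_eq_tsum ht a b X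
  have hne : ∑' l : L, (Rect (t * a) (t * b)).indicator (fun _ => (1 : ENNReal)) ((l : Plane) + X)
      ≠ ⊤ := by rw [← h]; exact ENNReal.natCast_ne_top _
  have h2 := ENNReal.hasSum_toReal hne
  rw [← ENNReal.tsum_toReal_eq (ENNReal.ne_top_of_tsum_ne_top hne), ← h] at h2
  have h3 := Complex.hasSum_ofReal.mpr h2
  convert h3 using 1
  · ext l
    by_cases hl : (l : Plane) + X ∈ Rect (t * a) (t * b) <;> simp [hl]
  · simp

lemma pointCount_vadd {t : ℝ} (ht : 0 < t) (a b : ℝ) (g : L) (X : Plane) :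
    pointCount t (Rect a b) ((g : Plane) + X) L = pointCount t (Rect a b) X L := by
  have : dilateTranslate t (Rect a b) ((g : Plane) + X) ∩ (L : Set Plane)
      = (fun y => (g : Plane) + y) '' (dilateTranslate t (Rect a b) X ∩ (L : Set Plane)) := by
    ext y
    simp only [Set.mem_inter_iff, mem_dilateTranslate_Rect ht, Set.mem_image, SetLike.mem_coe]
    constructor
    · rintro ⟨h1, h2⟩
      refine ⟨y - g, ⟨?_, L.sub_mem h2 g.2⟩, by abel⟩
      rwa [sub_sub]
    · rintro ⟨z, ⟨h1, h2⟩, rfl⟩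
      refine ⟨?_, L.add_mem g.2 h2⟩
      rwa [add_sub_add_left_eq_sub]
  rw [pointCount, this, Set.ncard_image_of_injective _ (add_right_injective _), pointCount]

variable [DiscreteTopology L] [IsZLattice ℝ L]

lemma setIntegral_eq_of_fundamentalDomain {D D' : Set Plane}
    (hD : IsAddFundamentalDomain L D volume) (hD' : IsAddFundamentalDomain L D' volume)
    {E : Type*} [NormedAddCommGroup E] [NormedSpace ℝ E] (f : Plane → E)
    (hf : ∀ (g : L) (X : Plane), f ((g : Plane) + X) = f X) :
    ∫ X in D, f X = ∫ X in D', f X := by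
  have : MeasurableVAdd L Plane := (inferInstance : MeasurableVAdd L.toAddSubgroup Plane)
  have : VAddInvariantMeasure L Plane volume :=
    (inferInstance : VAddInvariantMeasure L.toAddSubgroup Plane volume)
  exact hD.setIntegral_eq hD' hf

/-- Unfolding: the integral over a fundamental domain of a periodization. -/
lemma setIntegral_tsum_eq_integral {D : Set Plane} (hD : IsAddFundamentalDomain L D volume)
    {φ : Plane → ℂ} (hm : Measurable φ) (hφ : Integrable φ) :
    ∫ X in D, ∑' l : L, φ ((l : Plane) + X) = ∫ X, φ X := by
  have : MeasurableVAdd L Plane := (inferInstance : MeasurableVAdd L.toAddSubgroup Plane)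
  have : VAddInvariantMeasure L Plane volume :=
    (inferInstance : VAddInvariantMeasure L.toAddSubgroup Plane volume)
  rw [hD.integral_eq_tsum'' φ hφ, integral_tsum]
  · rfl
  · exact fun l => (hm.comp (measurable_const_add _)).aestronglyMeasurable
  · have := hD.lintegral_eq_tsum'' (fun X => ‖φ X‖ₑ)
    change _ = ∑' l : L, ∫⁻ X in D, ‖φ ((l : Plane) + X)‖ₑ at this
    rw [← this]
    exact hφ.2.ne

/-- Integration over the unit square in the coordinates of a basis. -/
lemma setIntegral_unitBox_eq (b : Module.Basis (Fin 2) ℤ L) {E : Type*} [NormedAddCommGroup E]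
    [NormedSpace ℝ E] (g : Plane → E) :
    ∫ u in unitBox, g ((b.ofZLatticeBasis ℝ).equivFun.symm u)
      = (ZLattice.covolume L)⁻¹ • ∫ X in ZSpan.fundamentalDomain (b.ofZLatticeBasis ℝ), g X := by
  set B := b.ofZLatticeBasis ℝ
  let e : Plane ≃ᵐ (Fin 2 → ℝ) := B.equivFunL.toHomeomorph.toMeasurableEquiv
  have he : ∀ x, e x = B.equivFun x := fun _ => rfl
  have hes : ∀ u, e.symm u = B.equivFun.symm u := fun _ => rfl
  have hpos := ZLattice.covolume_pos L volume
  have hmap : Measure.map e.symm volume = ENNReal.ofReal (ZLattice.covolume L)⁻¹ • volume := by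
    ext s hs
    rw [e.symm.map_apply, Measure.smul_apply, smul_eq_mul, ENNReal.ofReal_inv_of_pos hpos, mul_comm,
      ← div_eq_mul_inv, ← ZLattice.volume_image_eq_volume_div_covolume' L b
        hs.nullMeasurableSet]
    congr 1
    exact (e.image_eq_preimage_symm s).symm
  -- The torus uses intervals open on the left, the fundamental domain intervals open on the right;
  -- they differ by a null set.
  have hbox : unitBox =ᵐ[volume] Set.pi Set.univ fun _ : Fin 2 => Set.Ico (0 : ℝ) 1 := by
    have h : unitBox = Set.pi Set.univ fun _ : Fin 2 => Set.Ioc (0 : ℝ) 1 := by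
      ext u; simp [unitBox]
    rw [h]
    exact (Measure.univ_pi_Ioc_ae_eq_Icc (f := fun _ : Fin 2 => (0 : ℝ)) (g := fun _ => 1)).trans
      (Measure.univ_pi_Ico_ae_eq_Icc (f := fun _ : Fin 2 => (0 : ℝ)) (g := fun _ => 1)).symm
  have hpre : e.symm ⁻¹' ZSpan.fundamentalDomain B
      = Set.pi Set.univ fun _ : Fin 2 => Set.Ico (0 : ℝ) 1 := by
    ext u
    simp only [Set.mem_preimage, hes, ZSpan.mem_fundamentalDomain, Set.mem_pi, Set.mem_univ,
      true_imp_iff]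
    refine forall_congr' fun i => ?_
    rw [← B.equivFun_apply, LinearEquiv.apply_symm_apply]
  rw [setIntegral_congr_set hbox, ← hpre]
  simp only [← hes]
  rw [← e.symm.measurableEmbedding.setIntegral_map (μ := volume) g, hmap, Measure.restrict_smul,
    integral_smul_measure, ENNReal.toReal_ofReal (inv_nonneg.mpr hpos.le)]

lemma inner_dualVec_equivFun_symm (b : Module.Basis (Fin 2) ℤ L) (k : Fin 2 → ℤ) (u : Fin 2 → ℝ) :
    inner ℝ ((b.ofZLatticeBasis ℝ).equivFun.symm u) (dualVec b k) = k 0 * u 0 + k 1 * u 1 := by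
  rw [Module.Basis.equivFun_symm_apply, Fin.sum_univ_two, inner_add_left, real_inner_smul_left,
    real_inner_smul_left, Module.Basis.ofZLatticeBasis_apply, Module.Basis.ofZLatticeBasis_apply,
    inner_dualVec, inner_dualVec]
  ring

end counting

/-! ### Fourier coefficients of the point count -/

section fourier

/-- The character `X ↦ exp(-2πi⟨X, m⟩)`. -/
def planeChar (m X : Plane) : ℂ := Complex.exp (-(2 * Real.pi * Complex.I * (inner ℝ X m : ℝ)))

lemma planeChar_vadd {L : Submodule ℤ Plane} {m : Plane} (hm : m ∈ dualLattice L) {l : Plane}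
    (hl : l ∈ L) (X : Plane) : planeChar m (l + X) = planeChar m X := by
  obtain ⟨n, hn⟩ := hm l hl
  rw [planeChar, planeChar, inner_add_left, hn, Complex.exp_eq_exp_iff_exists_int]
  exact ⟨-n, by push_cast; ring⟩

lemma measurable_planeChar (m : Plane) : Measurable (planeChar m) := by
  have : Continuous (planeChar m) := by unfold planeChar; fun_prop
  exact this.measurable

lemma norm_planeChar (m X : Plane) : ‖planeChar m X‖ = 1 := by
  rw [planeChar, show -(2 * Real.pi * Complex.I * (inner ℝ X m : ℝ) : ℂ)
    = ((-(2 * Real.pi * inner ℝ X m) : ℝ) : ℂ) * Complex.I by push_cast; ring]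
  exact Complex.norm_exp_ofReal_mul_I _

lemma integral_exp_interval (A : ℝ) {m : ℝ} (hm : m ≠ 0) :
    ∫ x in (-A)..A, Complex.exp (-(2 * Real.pi * Complex.I * (m * x : ℝ)))
      = ((Real.sin (2 * Real.pi * A * m) / (Real.pi * m) : ℝ) : ℂ) := by
  have hpi : (Real.pi : ℂ) ≠ 0 := by exact_mod_cast Real.pi_ne_zero
  have hm' : (m : ℂ) ≠ 0 := by exact_mod_cast hm
  have hc : -(2 * Real.pi * Complex.I * m : ℂ) ≠ 0 := by simp [hpi, hm']
  have h := integral_exp_mul_complex (a := -A) (b := A) hc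
  have e : ∀ x : ℝ, -(2 * Real.pi * Complex.I * (m * x : ℝ) : ℂ)
      = -(2 * Real.pi * Complex.I * m : ℂ) * x := fun x => by push_cast; ring
  simp only [e, h]
  push_cast
  rw [Complex.sin, div_eq_div_iff hc (mul_ne_zero hpi hm'),
    show -(2 * Real.pi * Complex.I * m : ℂ) * A = -(2 * Real.pi * A * m) * Complex.I by ring,
    show -(2 * Real.pi * Complex.I * m : ℂ) * -A = 2 * Real.pi * A * m * Complex.I by ring]
  linear_combination (Complex.exp (-(2 * Real.pi * A * m) * Complex.I) -
    Complex.exp (2 * Real.pi * A * m * Complex.I)) * (Real.pi * m) * Complex.I_sq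

/-- The Fourier transform of a rectangle. -/
lemma integral_indicator_Rect_mul_planeChar {A B : ℝ} (hA : 0 ≤ A) (hB : 0 ≤ B) {m : Plane}
    (h0 : m 0 ≠ 0) (h1 : m 1 ≠ 0) :
    ∫ X, (Rect A B).indicator (fun _ => (1 : ℂ)) X * planeChar m X
      = ((Real.sin (2 * Real.pi * A * m 0) / (Real.pi * m 0) *
          (Real.sin (2 * Real.pi * B * m 1) / (Real.pi * m 1)) : ℝ) : ℂ) := by
  set h : Fin 2 → ℝ → ℂ := fun i => (Set.Icc (-(![A, B] i)) (![A, B] i)).indicator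
    (fun x => Complex.exp (-(2 * Real.pi * Complex.I * (m i * x : ℝ)))) with hh
  have hprod : ∀ X : Plane, (Rect A B).indicator (fun _ => (1 : ℂ)) X * planeChar m X
      = ∏ i, h i ((MeasurableEquiv.toLp 2 (Fin 2 → ℝ)).symm X i) := by
    intro X
    change _ = ∏ i, h i (X i)
    have hX : X ∈ Rect A B ↔ X 0 ∈ Set.Icc (-A) A ∧ X 1 ∈ Set.Icc (-B) B := by
      simp [Rect, abs_le]
    rw [Fin.prod_univ_two]
    by_cases hX0 : X 0 ∈ Set.Icc (-A) A
    · by_cases hX1 : X 1 ∈ Set.Icc (-B) B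
      · rw [Set.indicator_of_mem (hX.mpr ⟨hX0, hX1⟩), one_mul, planeChar, Plane.inner_eq]
        simp only [hh, Matrix.cons_val_zero, Matrix.cons_val_one]
        rw [Set.indicator_of_mem hX0, Set.indicator_of_mem hX1, ← Complex.exp_add]
        congr 1
        push_cast
        ring
      · rw [Set.indicator_of_notMem (fun h => hX1 (hX.mp h).2), zero_mul]
        simp only [hh, Matrix.cons_val_zero, Matrix.cons_val_one]
        rw [Set.indicator_of_notMem hX1, mul_zero]
    · rw [Set.indicator_of_notMem (fun h => hX0 (hX.mp h).1), zero_mul]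
      simp only [hh, Matrix.cons_val_zero, Matrix.cons_val_one]
      rw [Set.indicator_of_notMem hX0, zero_mul]
  have hone : ∀ i, 0 ≤ (![A, B] i) → m i ≠ 0 → ∫ x, h i x
      = ((Real.sin (2 * Real.pi * (![A, B] i) * m i) / (Real.pi * m i) : ℝ) : ℂ) := by
    intro i hi hmi
    rw [integral_indicator measurableSet_Icc, integral_Icc_eq_integral_Ioc,
      ← intervalIntegral.integral_of_le (by linarith), integral_exp_interval _ hmi]
  simp only [hprod]
  rw [(EuclideanSpace.volume_preserving_symm_measurableEquiv_toLp (Fin 2)).integral_comp'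
      (fun u : Fin 2 → ℝ => ∏ i, h i (u i)), integral_fintype_prod_volume_eq_prod,
    Fin.prod_univ_two, hone 0 (by simpa) h0, hone 1 (by simpa) h1]
  push_cast
  simp

variable {L : Submodule ℤ Plane} [DiscreteTopology L] [IsZLattice ℝ L]

lemma integrable_indicator_Rect_mul_planeChar {A B : ℝ} (hA : 0 ≤ A) (m : Plane) :
    Integrable fun X => (Rect A B).indicator (fun _ => (1 : ℂ)) X * planeChar m X := by
  have h1 : Integrable ((Rect A B).indicator fun _ : Plane => (1 : ℂ)) := by
    rw [integrable_indicator_iff (measurableSet_Rect A B)]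
    refine integrableOn_const ?_
    rw [volume_Rect A B hA]
    exact ENNReal.ofReal_ne_top
  exact h1.mul_bdd (c := 1) (measurable_planeChar m).aestronglyMeasurable
    (Eventually.of_forall fun X => (norm_planeChar m X).le)

/-- A character of a dual vector is L-periodic, so it moves inside the periodization and the
integral unfolds to the whole plane. -/
lemma Admissible.boxCoeff_pointCount (hL : Admissible L) (b : Module.Basis (Fin 2) ℤ L) {t : ℝ}
    (ht : 0 < t) {α β : ℝ} (hα : 0 < α) (k : Fin 2 → ℤ) :
    boxCoeff (fun u => (pointCount t (Rect α β) ((b.ofZLatticeBasis ℝ).equivFun.symm u) L : ℂ)) k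
      = (ZLattice.covolume L)⁻¹ • ∫ X, (Rect (t * α) (t * β)).indicator (fun _ => (1 : ℂ)) X
          * planeChar (dualVec b k) X := by
  set φ : Plane → ℂ := fun X => (Rect (t * α) (t * β)).indicator (fun _ => (1 : ℂ)) X
    * planeChar (dualVec b k) X with hφ
  have hφm : Measurable φ :=
    (measurable_const.indicator (measurableSet_Rect _ _)).mul (measurable_planeChar _)
  rw [← setIntegral_tsum_eq_integral (ZLattice.isAddFundamentalDomain b volume) hφm
    (integrable_indicator_Rect_mul_planeChar (by positivity) _), ← setIntegral_unitBox_eq b, boxCoeff]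
  refine integral_congr_ae (Eventually.of_forall fun u => ?_)
  simp only [hφ, planeChar_vadd (dualVec_mem b k) (Subtype.coe_prop _)]
  rw [((hL.hasSum_pointCount ht α β _).mul_right _).tsum_eq, planeChar, inner_dualVec_equivFun_symm,
    mul_comm]
  push_cast
  rfl

/-- Parseval's formula for the counting error of a rectangle. -/
lemma Admissible.hasSum_periodMean (hL : Admissible L) {D : Set Plane}
    (hD : IsAddFundamentalDomain L D volume) {t : ℝ} (ht : 0 < t) {α β : ℝ} (hα : 0 < α)
    (hβ : 0 < β) :
    HasSum (fun m : dualLattice L => weight m *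
        (Real.sin (2 * Real.pi * α * t * (m : Plane) 0) ^ 2 *
          Real.sin (2 * Real.pi * β * t * (m : Plane) 1) ^ 2))
      (Real.pi ^ 4 * ZLattice.covolume L ^ 2 *
        periodMean L D fun X => countError t (Rect α β) X L ^ 2) := by
  set V := ZLattice.covolume L with hV
  have hpos : 0 < V := ZLattice.covolume_pos L volume
  set b := planeBasis L
  set A := (b.ofZLatticeBasis ℝ).equivFun.symm with hA
  set N : Plane → ℝ := fun X => (pointCount t (Rect α β) X L : ℝ) with hN
  have hNm : Measurable N := hL.measurable_pointCount ht α β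
  obtain ⟨n, hn⟩ := hL.exists_pointCount_le ht α β
  have hAm : Measurable A := (b.ofZLatticeBasis ℝ).equivFunL.symm.continuous.measurable
  have hpars := hasSum_sq_boxCoeff (f := fun u => (pointCount t (Rect α β) (A u) L : ℂ)) (C := n)
    (by
      have := Complex.measurable_ofReal.comp (hNm.comp hAm)
      simpa [hN, Function.comp_def] using this)
    (fun u => by simpa using (hn (A u)).2)
  set c : (Fin 2 → ℤ) → ℂ :=
    boxCoeff (fun u => (pointCount t (Rect α β) (A u) L : ℂ)) with hc
  set D₀ := ZSpan.fundamentalDomain (b.ofZLatticeBasis ℝ)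
  have hD₀ : IsAddFundamentalDomain L D₀ volume := ZLattice.isAddFundamentalDomain b volume
  have hvol : volume.real D₀ = V := (ZLattice.covolume_eq_measure_fundamentalDomain L volume hD₀).symm
  have hfin : volume D₀ ≠ ⊤ := (ZSpan.fundamentalDomain_isBounded _).measure_lt_top.ne
  have hR : volume.real (Rect α β) = 4 * (α * β) := by
    rw [measureReal_def, volume_Rect α β hα.le, ENNReal.toReal_ofReal (by positivity)]
  set μ : ℝ := t ^ 2 * (volume.real (Rect α β) / V) with hμ
  have hvolQ : ∫ X, (Rect (t * α) (t * β)).indicator (fun _ => (1 : ℂ)) X = (V * μ : ℝ) := by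
    rw [integral_indicator (measurableSet_Rect _ _), setIntegral_const, measureReal_def,
      volume_Rect _ _ (by positivity), ENNReal.toReal_ofReal (by positivity), hμ, hR]
    simp only [Complex.real_smul, mul_one]
    congr 1
    field_simp
  -- The zeroth coefficient is exactly the main term of the count, so passing to the error removes
  -- precisely the frequency 0.
  have hc0 : c 0 = (μ : ℂ) := by
    have h1 := hL.boxCoeff_pointCount b ht (β := β) hα 0
    have h2 : dualVec b 0 = 0 := by refine Plane.ext ?_ ?_ <;> simp [dualVec]
    have h3 : ∀ X, planeChar 0 X = 1 := fun X => by simp [planeChar]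
    simp only [h2, h3, mul_one] at h1
    rw [hc, h1, hvolQ, ← hV]
    simp only [Complex.real_smul, ← Complex.ofReal_mul]
    congr 1
    field_simp
  have hNint : IntegrableOn N D₀ := by
    refine IntegrableOn.of_bound hfin.lt_top hNm.aestronglyMeasurable n
      (Eventually.of_forall fun X => ?_)
    simpa [hN] using (hn X).2
  have hN2int : IntegrableOn (fun X => N X ^ 2) D₀ := by
    refine IntegrableOn.of_bound hfin.lt_top (hNm.pow_const 2).aestronglyMeasurable ((n : ℝ) ^ 2)
      (Eventually.of_forall fun X => ?_)
    rw [norm_pow]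
    gcongr
    simpa [hN] using (hn X).2
  have hN1 : ∫ X in D₀, N X = V * μ := by
    have h1 : c 0 = ((V⁻¹ * ∫ X in D₀, N X : ℝ) : ℂ) := by
      rw [hc, boxCoeff]
      have h2 := setIntegral_unitBox_eq b N
      rw [smul_eq_mul] at h2
      rw [← hV] at h2
      rw [← h2, ← integral_complex_ofReal]
      simp [hN, hA]
    rw [hc0] at h1
    have h2 := Complex.ofReal_injective h1
    rw [h2]; field_simp
  have hmean : periodMean L D (fun X => countError t (Rect α β) X L ^ 2)
      = (∫ u in unitBox, ‖(pointCount t (Rect α β) (A u) L : ℂ)‖ ^ 2) - ‖c 0‖ ^ 2 := by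
    have h1 := setIntegral_unitBox_eq b (fun X => N X ^ 2)
    rw [periodMean, setIntegral_eq_of_fundamentalDomain hD hD₀ _ fun g X => by
      rw [countError, countError, pointCount_vadd ht]]
    have h2 : ∫ X in D₀, countError t (Rect α β) X L ^ 2
        = (∫ X in D₀, N X ^ 2) - V * μ ^ 2 := by
      have e : ∀ X, countError t (Rect α β) X L ^ 2 = N X ^ 2 - 2 * μ * N X + μ ^ 2 := fun X => by
        rw [countError]; change (N X - μ) ^ 2 = _; ring
      simp only [e]
      have i1 : IntegrableOn (fun X => 2 * μ * N X) D₀ := hNint.const_mul _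
      have i2 : IntegrableOn (fun X => N X ^ 2 - 2 * μ * N X) D₀ := hN2int.sub i1
      rw [integral_add i2 (integrableOn_const hfin), integral_sub hN2int i1,
        integral_const_mul, hN1, setIntegral_const, hvol,
        smul_eq_mul]
      ring
    have h3 : ∀ u, ‖(pointCount t (Rect α β) (A u) L : ℂ)‖ ^ 2 = N (A u) ^ 2 := fun u => by
      simp [hN]
    simp only [h3]
    rw [h1, h2, hc0, Complex.norm_real, smul_eq_mul, Real.norm_eq_abs, sq_abs, ← hV]
    field_simp
    rfl
  have hsub : HasSum (fun k => ‖c k‖ ^ 2 - if k = 0 then ‖c 0‖ ^ 2 else 0)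
      (periodMean L D fun X => countError t (Rect α β) X L ^ 2) := by
    rw [hmean]
    exact hpars.sub (hasSum_ite_eq 0 _)
  rw [← (dualEquiv b).hasSum_iff]
  refine Eq.subst (motive := fun f => HasSum f _) (funext fun k => ?_)
    (hsub.mul_left (Real.pi ^ 4 * V ^ 2))
  symm
  have hmem : ((dualEquiv b k : dualLattice L) : Plane) = dualVec b k := rfl
  have hk0 : dualEquiv b k = 0 ↔ k = 0 := by
    have : dualEquiv b 0 = 0 := Subtype.ext (by
      change dualVec b 0 = 0
      refine Plane.ext ?_ ?_ <;> simp [dualVec])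
    rw [← this, (dualEquiv b).injective.eq_iff]
  simp only [Function.comp_apply]
  -- At frequency 0 the weight is 1/0 = 0, matching the removed coefficient.
  by_cases hk : k = 0
  · rw [hk0.mpr hk]
    simp [hk, weight]
  rw [if_neg hk, sub_zero, hmem]
  have hne : dualVec b k ≠ 0 := fun h => hk (hk0.mp (Subtype.ext h))
  obtain ⟨n0, n1⟩ := hL.dual.coord_ne_zero (dualVec_mem b k) hne
  have hpi := Real.pi_ne_zero
  rw [hc, hL.boxCoeff_pointCount b ht hα k, integral_indicator_Rect_mul_planeChar (by positivity)
    (by positivity) n0 n1, Complex.real_smul, ← Complex.ofReal_mul, Complex.norm_real,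
    Real.norm_eq_abs, sq_abs, ← hV,
    show 2 * Real.pi * (t * α) * dualVec b k 0 = 2 * Real.pi * α * t * dualVec b k 0 by ring,
    show 2 * Real.pi * (t * β) * dualVec b k 1 = 2 * Real.pi * β * t * dualVec b k 1 by ring, weight]
  field_simp

end fourier

/-! ### Convergence to a constant under the dilated laws -/

/-- Convergence in probability to a constant implies convergence in distribution, also when the
probability spaces vary. -/
lemma tendstoInDistribution_dirac {ι Ω : Type*} [MeasurableSpace Ω] {l : Filter ι}
    {X : ι → Ω → ℝ} {μ : ι → Measure Ω} [∀ i, IsProbabilityMeasure (μ i)]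
    (hX : ∀ i, AEMeasurable (X i) (μ i)) {c : ℝ}
    (h : ∀ ε : ℝ, 0 < ε → Tendsto (fun i => μ i {ω | ε ≤ |X i ω - c|}) l (𝓝 0)) :
    TendstoInDistribution X l (id : ℝ → ℝ) μ (Measure.dirac c) where
  forall_aemeasurable := hX
  aemeasurable_limit := aemeasurable_id
  tendsto := by
    refine ProbabilityMeasure.tendsto_iff_forall_integral_tendsto.mpr fun f => ?_
    have hlim : ∫ x, f x ∂(Measure.map (id : ℝ → ℝ) (Measure.dirac c)) = f c := by
      rw [Measure.map_id, integral_dirac]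
    have hmap : ∀ i, ∫ x, f x ∂((μ i).map (X i)) = ∫ ω, f (X i ω) ∂(μ i) := fun i =>
      integral_map (hX i) f.continuous.aestronglyMeasurable
    change Tendsto (fun i => ∫ x, f x ∂((μ i).map (X i))) l
      (𝓝 (∫ x, f x ∂(Measure.map (id : ℝ → ℝ) (Measure.dirac c))))
    simp only [hlim, hmap]
    rw [Metric.tendsto_nhds]
    intro ε hε
    obtain ⟨δ, hδ, hf⟩ := Metric.continuous_iff.mp f.continuous c (ε / 2) (by positivity)
    set K : ℝ := 2 * ‖f‖ + 1
    have hK : 0 < K := by positivity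
    have hsmall : ∀ᶠ i in l, μ i {ω | δ ≤ |X i ω - c|} < ENNReal.ofReal (ε / (2 * K)) :=
      (h δ hδ).eventually_lt_const (by positivity)
    filter_upwards [hsmall] with i hi
    -- The variables are only a.e. measurable, so the exceptional event is replaced by a measurable
    -- hull of the same measure.
    set A := toMeasurable (μ i) {ω | δ ≤ |X i ω - c|}
    have hA : MeasurableSet A := measurableSet_toMeasurable _ _
    have hAlt : (μ i).real A < ε / (2 * K) := by
      rw [measureReal_def, measure_toMeasurable]
      exact (ENNReal.lt_ofReal_iff_toReal_lt (measure_ne_top _ _)).mp hi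
    have hint : Integrable (fun ω => f (X i ω)) (μ i) :=
      Integrable.of_bound (f.continuous.measurable.comp_aemeasurable (hX i)).aestronglyMeasurable ‖f‖
        (Eventually.of_forall fun ω => f.norm_coe_le_norm _)
    have hconst : ∫ _, f c ∂(μ i) = f c := by simp
    have hpt : ∀ ω, ‖f (X i ω) - f c‖ ≤ ε / 2 + A.indicator (fun _ => K) ω := by
      intro ω
      by_cases hω : ω ∈ A
      · rw [Set.indicator_of_mem hω]
        have := norm_sub_le (f (X i ω)) (f c)
        have := f.norm_coe_le_norm (X i ω)
        have := f.norm_coe_le_norm c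
        simp only [K]
        linarith
      · rw [Set.indicator_of_notMem hω, add_zero]
        have : ¬ δ ≤ |X i ω - c| := fun hh => hω (subset_toMeasurable _ _ hh)
        exact (hf _ (not_le.mp this)).le
    have hi2 : Integrable (A.indicator fun _ => K) (μ i) := (integrable_const K).indicator hA
    calc dist (∫ ω, f (X i ω) ∂(μ i)) (f c) = ‖∫ ω, (f (X i ω) - f c) ∂(μ i)‖ := by
          rw [integral_sub hint (integrable_const _), hconst, dist_eq_norm]
      _ ≤ ∫ ω, (ε / 2 + A.indicator (fun _ => K) ω) ∂(μ i) :=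
          norm_integral_le_of_norm_le ((integrable_const _).add hi2) (Eventually.of_forall hpt)
      _ = ε / 2 + (μ i).real A * K := by
          rw [integral_add (integrable_const _) hi2, integral_indicator_const _ hA]
          simp
      _ < ε / 2 + ε / (2 * K) * K := by gcongr
      _ = ε := by field_simp; norm_num

/-- The law of density `ρ` on `[0, 1]`. -/
def UnitDensity.law (ρ : UnitDensity) : Measure ℝ :=
  (volume.restrict (Set.Icc 0 1)).withDensity fun x => ENNReal.ofReal (ρ.toFun x)

/-- Refers all the laws to one measure on [0, 1], so that absolute continuity gives a threshold
independent of T. -/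
lemma UnitDensity.dilatedLaw_eq_map (ρ : UnitDensity) {T : ℝ} (hT : 0 < T) :
    ρ.dilatedLaw T = ρ.law.map fun x => T * x := by
  have hemb : MeasurableEmbedding fun x : ℝ => T * x := (Homeomorph.mulLeft₀ T hT.ne').measurableEmbedding
  ext s hs
  have hpre : (fun x => T * x) ⁻¹' Set.Icc 0 T = Set.Icc 0 1 := by
    ext x
    simp only [Set.mem_preimage, Set.mem_Icc]
    refine and_congr (by rw [mul_nonneg_iff_of_pos_left hT]) ?_
    exact mul_le_iff_le_one_right hT
  have key : ∀ G : ℝ → ENNReal, ∫⁻ t, G t = ENNReal.ofReal T * ∫⁻ x, G (T * x) := fun G => by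
    conv_lhs => rw [← Real.smul_map_volume_mul_left hT.ne']
    rw [lintegral_smul_measure, hemb.lintegral_map, abs_of_pos hT, smul_eq_mul]
  rw [hemb.map_apply, UnitDensity.law, UnitDensity.dilatedLaw, withDensity_apply',
    withDensity_apply', Measure.restrict_restrict hs, Measure.restrict_restrict (hemb.measurable hs),
    ← hpre, ← Set.preimage_inter, ← lintegral_indicator (hs.inter measurableSet_Icc), key,
    ← lintegral_indicator (hemb.measurable (hs.inter measurableSet_Icc)),
    ← lintegral_const_mul' _ _ ENNReal.ofReal_ne_top]
  refine lintegral_congr fun x => ?_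
  by_cases hx : T * x ∈ s ∩ Set.Icc 0 T
  · rw [Set.indicator_of_mem hx, Set.indicator_of_mem (by exact hx), ← ENNReal.ofReal_mul hT.le,
      mul_div_cancel_left₀ _ hT.ne', ← mul_assoc, mul_one_div_cancel hT.ne', one_mul]
  · rw [Set.indicator_of_notMem hx, Set.indicator_of_notMem (by exact hx), mul_zero]

lemma UnitDensity.lintegral_ne_top (ρ : UnitDensity) :
    ∫⁻ x in Set.Icc (0 : ℝ) 1, ENNReal.ofReal (ρ.toFun x) ≠ ⊤ := by
  have h3 : Integrable ρ.toFun (volume.restrict (Set.Icc 0 1)) := by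
    by_contra h
    have := ρ.integral_eq_one
    rw [integral_undef h] at this
    exact zero_ne_one this
  refine ne_of_lt (lt_of_le_of_lt (lintegral_mono fun x => ?_) h3.2)
  exact Real.ofReal_le_enorm _

/-- Events of vanishing uniform probability have vanishing probability for the dilated laws. -/
lemma UnitDensity.tendsto_dilatedLaw (ρ : UnitDensity) {A : Set ℝ}
    (hA : ∀ η : ℝ, 0 < η → ∀ᶠ T : ℝ in atTop,
      volume (A ∩ Set.Icc 0 T) ≤ ENNReal.ofReal (η * T)) :
    Tendsto (fun T : Set.Ioi (0 : ℝ) => ρ.dilatedLaw (T : ℝ) A) atTop (𝓝 0) := by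
  rw [ENNReal.tendsto_nhds_zero]
  intro ε hε
  obtain ⟨δ, hδ, h⟩ := exists_pos_setLIntegral_lt_of_measure_lt ρ.lintegral_ne_top hε.ne'
  obtain ⟨η, hη0, hηδ⟩ := ENNReal.lt_iff_exists_nnreal_btwn.mp hδ
  have hη0 : 0 < (η : ℝ) := by exact_mod_cast hη0
  have hval : Tendsto (Subtype.val : Set.Ioi (0 : ℝ) → ℝ) atTop atTop :=
    tendsto_comp_val_Ioi_atTop.mpr tendsto_id
  filter_upwards [hval.eventually (hA η hη0)] with T hT
  obtain ⟨T, hT0⟩ := T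
  have hT0 : 0 < T := hT0
  simp only at hT
  have hemb : MeasurableEmbedding fun x : ℝ => T * x :=
    (Homeomorph.mulLeft₀ T hT0.ne').measurableEmbedding
  have hpre : (fun x => T * x) ⁻¹' Set.Icc 0 T = Set.Icc 0 1 := by
    ext x
    simp only [Set.mem_preimage, Set.mem_Icc]
    exact and_congr (by rw [mul_nonneg_iff_of_pos_left hT0]) (mul_le_iff_le_one_right hT0)
  change ρ.dilatedLaw T A ≤ ε
  rw [ρ.dilatedLaw_eq_map hT0, hemb.map_apply, UnitDensity.law, withDensity_apply']
  refine (h _ (lt_of_le_of_lt ?_ hηδ)).le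
  rw [Measure.restrict_apply' measurableSet_Icc, ← hpre, ← Set.preimage_inter,
    Real.volume_preimage_mul_left hT0.ne', abs_of_pos (inv_pos.mpr hT0)]
  calc ENNReal.ofReal T⁻¹ * volume (A ∩ Set.Icc 0 T)
      ≤ ENNReal.ofReal T⁻¹ * ENNReal.ofReal (η * T) := by gcongr
    _ = η := by
        rw [← ENNReal.ofReal_mul (inv_nonneg.mpr hT0.le), mul_comm (η : ℝ) T,
          inv_mul_cancel_left₀ hT0.ne', ENNReal.ofReal_coe_nnreal]

/-! ### Chebyshev bound for the normalized sine sum -/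

section deviation

variable {M : Submodule ℤ Plane}

lemma Admissible.exists_sineSum_le_of_hasSum (hM : Admissible M) (α β : ℝ) :
    ∃ C : ℝ, 0 < C ∧ ∀ T t S : ℝ, 0 < T → 0 ≤ t → t ≤ T →
      HasSum (fun m : M => weight m * (Real.sin (α * t * (m : Plane) 0) ^ 2 *
        Real.sin (β * t * (m : Plane) 1) ^ 2)) S →
      sineSum M α β T t ≤ S ∧ S ≤ sineSum M α β T t + C := by
  classical
  obtain ⟨C, hC, h⟩ := hM.exists_sum_tail_le α β
  refine ⟨C, hC, fun T t S hT ht htT hS => ?_⟩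
  set g : Plane → ℝ := fun m => weight m * (Real.sin (α * t * m 0) ^ 2 * Real.sin (β * t * m 1) ^ 2)
    with hg
  have hg0 : ∀ m, 0 ≤ g m := fun m => mul_nonneg (weight_nonneg m) (by positivity)
  constructor
  · have h1 := sum_le_hasSum ((ballFinset M T).subtype (· ∈ M)) (fun m _ => hg0 m) hS
    rwa [Finset.sum_subtype_of_mem g fun x hx => (hM.mem_ballFinset.mp hx).1] at h1
  · refine hasSum_le_of_sum_le hS fun s => ?_
    -- The zero vector has weight 0 and lies in neither the punctured ball nor the tail, so it is
    -- discarded.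
    have h1 : ∑ m ∈ s, g m = ∑ x ∈ (s.map (Function.Embedding.subtype _)).erase 0, g x := by
      rw [Finset.sum_erase _ (by simp [hg, weight]), Finset.sum_map]
      rfl
    change ∑ m ∈ s, g m ≤ _
    rw [h1, ← Finset.sum_filter_add_sum_filter_not _ (fun x => x ∈ ballFinset M T)]
    refine add_le_add ?_ (h T t hT ht htT _ fun l hl => ?_)
    · exact Finset.sum_le_sum_of_subset_of_nonneg (fun l hl => (Finset.mem_filter.mp hl).2)
        fun l _ _ => hg0 l
    · rw [Finset.mem_filter, Finset.mem_erase, Finset.mem_map] at hl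
      obtain ⟨⟨hl0, m, -, rfl⟩, hnot⟩ := hl
      refine ⟨m.2, ?_⟩
      by_contra hle
      exact hnot (hM.mem_ballFinset.mpr ⟨m.2, norm_pos_iff.mpr hl0, not_lt.mp hle⟩)

lemma Admissible.tendsto_latticeSum (hM : Admissible M) (hK : HasBoxVectors M) :
    Tendsto (latticeSum M) atTop atTop := by
  obtain ⟨C, hC, h⟩ := hM.exists_log_le_latticeSum hK
  exact tendsto_atTop_mono' _ h (Real.tendsto_log_atTop.const_mul_atTop (by positivity))

/-- The normalized sine sum is close to `1 / 4` at most times. -/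
lemma Admissible.eventually_volume_deviation_le (hM : Admissible M) (hK : HasBoxVectors M)
    {α β : ℝ} (hα : α ≠ 0) (hβ : β ≠ 0) {S : ℝ → ℝ}
    (hS : ∀ t, 0 < t → HasSum (fun m : M => weight m * (Real.sin (α * t * (m : Plane) 0) ^ 2 *
        Real.sin (β * t * (m : Plane) 1) ^ 2)) (S t)) {e η : ℝ} (he : 0 < e) (hη : 0 < η) :
    ∀ᶠ T : ℝ in atTop, volume ({t | e ≤ |S t / latticeSum M t - 1 / 4|} ∩ Set.Icc 0 T)
      ≤ ENNReal.ofReal (η * T) := by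
  obtain ⟨C₁, hC₁, htail⟩ := hM.exists_sineSum_le_of_hasSum α β
  obtain ⟨B, hB, hmom⟩ := hM.exists_sineSum_moment_le hα hβ
  -- Half of the allowed measure goes to the early times t ≤ θT, where V(t) may be far from V(T),
  -- and half to the Chebyshev bound.
  set θ := η / 2 with hθ
  have hθ0 : 0 < θ := by positivity
  obtain ⟨C₂, hC₂, hslow⟩ := hM.exists_latticeSum_mul_le θ⁻¹
  -- The three parts of the threshold make V(t) positive for t > θT, make the losses from the tail
  -- and from V(T) - V(t) at most eV/2, and bring the Chebyshev bound 4BT/(e²V) below θT.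
  filter_upwards [eventually_ge_atTop 1, (hM.tendsto_latticeSum hK).eventually_ge_atTop
    (C₂ + 1 + 2 * (e * C₂ + C₁ + C₂) / e + 8 * B / (e ^ 2 * η))] with T hT hV
  have hT0 : 0 < T := by linarith
  set V := latticeSum M T with hVdef
  have hq1 : 0 ≤ 2 * (e * C₂ + C₁ + C₂) / e := by positivity
  have hq2 : 0 ≤ 8 * B / (e ^ 2 * η) := by positivity
  have hV1 : C₂ + 1 ≤ V := by linarith
  have hV0 : 0 < V := by linarith
  have hV2 : 2 * (e * C₂ + C₁ + C₂) ≤ e * V := by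
    have : 2 * (e * C₂ + C₁ + C₂) / e ≤ V := by linarith
    rw [div_le_iff₀ he] at this; linarith
  have hV3 : 8 * B ≤ V * (e ^ 2 * η) := by
    have : 8 * B / (e ^ 2 * η) ≤ V := by linarith
    rwa [div_le_iff₀ (by positivity)] at this
  set E : ℝ → ℝ := fun t => (sineSum M α β T t - V / 4) ^ 2 with hE
  have hEc : Continuous E := by simp only [hE, sineSum]; fun_prop
  set Z : Set ℝ := {t | (e * V / 2) ^ 2 ≤ E t} with hZ
  have hsub : {t | e ≤ |S t / latticeSum M t - 1 / 4|} ∩ Set.Icc 0 T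
      ⊆ Set.Icc 0 (θ * T) ∪ (Z ∩ Set.Ioc 0 T) := by
    rintro t ⟨ht1, ht2, ht3⟩
    by_cases htθ : t ≤ θ * T
    · exact Or.inl ⟨ht2, htθ⟩
    have hθT : 0 < θ * T := by positivity
    have ht0 : 0 < t := hθT.trans (not_le.mp htθ)
    refine Or.inr ⟨?_, ht0, ht3⟩
    have hup : latticeSum M t ≤ V := hM.latticeSum_mono ht3
    have hlo : V ≤ latticeSum M t + C₂ := by
      have h1 := hslow (θ * T) hθT
      rw [inv_mul_cancel_left₀ hθ0.ne'] at h1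
      have h2 : latticeSum M (θ * T) ≤ latticeSum M t := hM.latticeSum_mono (not_le.mp htθ).le
      linarith
    obtain ⟨hs1, hs2⟩ := htail T t (S t) hT0 ht2 ht3 (hS t ht0)
    set v := latticeSum M t
    have hv : 0 < v := by linarith
    have ht1 : e ≤ |S t / v - 1 / 4| := ht1
    have hdev : e * v ≤ |S t - v / 4| := by
      have : S t - v / 4 = (S t / v - 1 / 4) * v := by field_simp
      rw [this, abs_mul, abs_of_pos hv]
      gcongr
    have habs : |S t - v / 4| ≤ |sineSum M α β T t - V / 4| + (C₁ + C₂) := by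
      have e1 : S t - v / 4 = (sineSum M α β T t - V / 4) 
          + ((S t - sineSum M α β T t) + (V - v) / 4) := by
        ring
      rw [e1]
      refine (abs_add_le _ _).trans ?_
      gcongr
      rw [abs_of_nonneg (by linarith)]
      linarith
    have hfin : e * V / 2 ≤ |sineSum M α β T t - V / 4| := by
      have : e * V ≤ e * v + e * C₂ := by nlinarith
      linarith
    change (e * V / 2) ^ 2 ≤ (sineSum M α β T t - V / 4) ^ 2
    rw [← sq_abs (sineSum M α β T t - V / 4)]
    gcongr
  have hcheb : volume (Z ∩ Set.Ioc 0 T) ≤ ENNReal.ofReal (θ * T) := by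
    have h1 := mul_meas_ge_le_integral_of_nonneg (μ := volume.restrict (Set.Ioc 0 T)) (f := E)
      (Eventually.of_forall fun t => sq_nonneg _)
      ((hEc.integrableOn_Icc (a := 0) (b := T)).mono_set Set.Ioc_subset_Icc_self) ((e * V / 2) ^ 2)
    rw [← intervalIntegral.integral_of_le hT0.le] at h1
    have h2 := h1.trans (hmom T hT)
    change (e * V / 2) ^ 2 * (volume.restrict (Set.Ioc 0 T)).real Z ≤ B * T * V at h2
    have h3 : (volume.restrict (Set.Ioc 0 T)).real Z ≤ θ * T := by
      have hp : 0 < (e * V / 2) ^ 2 := by positivity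
      refine le_of_mul_le_mul_left (h2.trans ?_) hp
      rw [hθ]
      have : 0 ≤ T * V := by positivity
      nlinarith
    rw [← Measure.restrict_apply' measurableSet_Ioc]
    rw [← ENNReal.ofReal_toReal (measure_ne_top (volume.restrict (Set.Ioc 0 T)) Z)]
    exact ENNReal.ofReal_le_ofReal h3
  calc _ ≤ volume (Set.Icc 0 (θ * T)) + volume (Z ∩ Set.Ioc 0 T) :=
        (measure_mono hsub).trans (measure_union_le _ _)
    _ ≤ ENNReal.ofReal (θ * T) + ENNReal.ofReal (θ * T) := by
        refine add_le_add ?_ hcheb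
        rw [Real.volume_Icc, sub_zero]
    _ = ENNReal.ofReal (η * T) := by
        rw [← ENNReal.ofReal_add (by positivity) (by positivity)]
        congr 1
        rw [hθ]; ring

end deviation

/-! ### The normalized second moment -/

section main

variable {L : Submodule ℤ Plane} [DiscreteTopology L] [IsZLattice ℝ L]

lemma Admissible.normalizedSecondMoment_eq (hL : Admissible L) (D : Set Plane) (P : Set Plane)
    (t : ℝ) : normalizedSecondMoment L D P t
      = (periodMean L D fun X => countError t P X L ^ 2) / latticeSum (dualLattice L) t := by
  simp only [normalizedSecondMoment, periodMean, div_pow, Real.sq_sqrt (hL.dual.latticeSum_nonneg t)]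
  rw [integral_div, mul_div_assoc]

/-- For t > 0, Parseval exhibits the moment as a countable sum of continuous functions divided by a
monotone one; the time t = 0 is a null set. -/
lemma Admissible.aemeasurable_normalizedSecondMoment (hL : Admissible L) {D : Set Plane}
    (hD : IsAddFundamentalDomain L D volume) {α β : ℝ} (hα : 0 < α) (hβ : 0 < β) (T : ℝ) :
    AEMeasurable (normalizedSecondMoment L D (Rect α β)) (volume.restrict (Set.Icc 0 T)) := by
  have : Countable (dualLattice L) := (dualEquiv (planeBasis L)).symm.injective.countable
  have hpos := ZLattice.covolume_pos L volume
  have hpi := Real.pi_pos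
  refine ⟨fun t => (∑' m : dualLattice L, weight m *
        (Real.sin (2 * Real.pi * α * t * (m : Plane) 0) ^ 2 *
          Real.sin (2 * Real.pi * β * t * (m : Plane) 1) ^ 2))
      / (Real.pi ^ 4 * ZLattice.covolume L ^ 2) / latticeSum (dualLattice L) t, ?_, ?_⟩
  · refine ((Measurable.tsum fun m => ?_).div_const _).div hL.dual.latticeSum_mono.measurable
    exact Continuous.measurable (by fun_prop)
  · have hne : ∀ᵐ t ∂(volume.restrict (Set.Icc 0 T)), t ≠ 0 :=
      ae_restrict_of_ae (by simp [ae_iff])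
    filter_upwards [hne, ae_restrict_mem measurableSet_Icc] with t ht0 ht
    have ht : 0 < t := lt_of_le_of_ne ht.1 ht0.symm
    rw [(hL.hasSum_periodMean hD ht hα hβ).tsum_eq, hL.normalizedSecondMoment_eq,
      mul_div_cancel_left₀ _ (by positivity)]

lemma Admissible.tendsto_dilatedLaw_deviation (hL : Admissible L) {D : Set Plane}
    (hD : IsAddFundamentalDomain L D volume) {α β : ℝ} (hα : 0 < α) (hβ : 0 < β) (ρ : UnitDensity)
    {ε : ℝ} (hε : 0 < ε) :
    Tendsto (fun T : Set.Ioi (0 : ℝ) => ρ.dilatedLaw (T : ℝ)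
        {t : ℝ | ε ≤ |normalizedSecondMoment L D (Rect α β) t
          - 1 / (4 * Real.pi ^ 4 * ZLattice.covolume L ^ 2)|}) atTop (𝓝 0) := by
  have hpos := ZLattice.covolume_pos L volume
  have hpi := Real.pi_pos
  set κ := Real.pi ^ 4 * ZLattice.covolume L ^ 2 with hκ
  have hκ0 : 0 < κ := by positivity
  refine ρ.tendsto_dilatedLaw fun η hη => ?_
  have h := hL.dual.eventually_volume_deviation_le hasBoxVectors_dual
    (α := 2 * Real.pi * α) (β := 2 * Real.pi * β) (by positivity) (by positivity)
    (fun t ht => hL.hasSum_periodMean hD ht hα hβ) (e := ε * κ) (by positivity) hη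
  filter_upwards [h] with T hT
  refine (measure_mono (Set.inter_subset_inter_left _ fun t ht => ?_)).trans hT
  have ht : ε ≤ |normalizedSecondMoment L D (Rect α β) t
    - 1 / (4 * Real.pi ^ 4 * ZLattice.covolume L ^ 2)| := ht
  rw [hL.normalizedSecondMoment_eq, show 4 * Real.pi ^ 4 * ZLattice.covolume L volume ^ 2 = 4 * κ by
    rw [hκ]; ring] at ht
  change ε * κ ≤ |κ * _ / _ - 1 / 4|
  -- The Parseval sum is κ times the moment, so a deviation ε of the moment is a deviation εκ from
  -- 1/4.
  have e : ∀ x v : ℝ, κ * x / v - 1 / 4 = (x / v - 1 / (4 * κ)) * κ := fun x v => by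
    field_simp
  rw [e, abs_mul, abs_of_pos hκ0]
  gcongr

end main

end

theorem theorem13 (L : Submodule ℤ Plane) [DiscreteTopology L] [IsZLattice ℝ L]
    (hL : Admissible L) :
    (∃ C : ℝ, 0 < C ∧ ∀ᶠ t : ℝ in atTop,
      1 / C * Real.log t ≤ latticeSum L t ∧ latticeSum L t ≤ C * Real.log t) ∧
    (∀ (a b : ℝ), 0 < a → 0 < b →
      ∀ (ρ : UnitDensity) (D : Set Plane), IsAddFundamentalDomain L D volume →
        TendstoInDistribution
          (fun (_ : Set.Ioi (0 : ℝ)) (t : ℝ) => normalizedSecondMoment L D (Rect a b) t)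
          atTop (id : ℝ → ℝ) (fun T : Set.Ioi (0 : ℝ) => ρ.dilatedLaw (T : ℝ))
          (Measure.dirac (1 / (4 * Real.pi ^ 4 * ZLattice.covolume L ^ 2))) ∧
        ∀ ε : ℝ, 0 < ε →
          Tendsto
            (fun T : Set.Ioi (0 : ℝ) => ρ.dilatedLaw (T : ℝ)
              {t : ℝ | ε ≤ |normalizedSecondMoment L D (Rect a b) t
                - 1 / (4 * Real.pi ^ 4 * ZLattice.covolume L ^ 2)|})
            atTop (𝓝 0)) := by
  refine ⟨hL.latticeSum_theta (hasBoxVectors L), fun a b ha hb ρ D hD => ?_⟩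
  have hprob := fun (ε : ℝ) (hε : 0 < ε) => hL.tendsto_dilatedLaw_deviation hD ha hb ρ hε
  have haem : ∀ T : Set.Ioi (0 : ℝ),
      AEMeasurable (normalizedSecondMoment L D (Rect a b)) (ρ.dilatedLaw (T : ℝ)) := fun T =>
    (hL.aemeasurable_normalizedSecondMoment hD ha hb T).mono_ac
      (withDensity_absolutelyContinuous _ _)
  exact ⟨tendstoInDistribution_dirac haem hprob, hprob⟩
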